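/- For $n\ge 1$ let $Q_n$ be the hypercube graph on the vertex set $\{0,1\}^n$, two vertices being adjacent if they differ in exactly one position, called the star position of that edge. Let $C_m$ denote the cycle of length $m$. For graphs $G,T,H$ let $N(G,T)$ be the number of subgraphs of $G$ isomorphic to $T$, let $\mathrm{ex}(G,T,H)$ be the maximum of $N(G',T)$ over all subgraphs $G'\subseteq G$ containing no subgraph isomorphic to $H$, and let $\mathbf d(G,T,H)=\mathrm{ex}(G,T,H)/N(G,T)$. Let $z_{\ell,\ell}$ be the number of subgraphs of $Q_\ell$ that are isomorphic to $C_{2\ell}$ and in which all $\ell$ positions occur as star positions of edges. **Theorem.** For every integer $k\ge 4$, $k\ne 5$, there is a constant $c_k>0$ depending only on $k$ such that the following holds for every integer $\ell\ge 2$ with $\ell\neq k$. We have $z_{\ell,\ell}>0$, and for every $n$ with $2\ell\le 2^n$ we have $N(Q_n,C_{2\ell})>0$ and $$\mathbf d(Q_n,C_{2\ell},C_{2k})\le c_k\,n^{-1/16}.$$ Moreover, for $n\ge \ell$, $$\binom{n}{\ell}^{-1}\,\frac{2^{\ell-\lceil\log_2(2\ell)\rceil}}{z_{\ell,\ell}}\,(1-o(1))\le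 \mathbf d(Q_n,C_{2\ell},C_{2k}),$$ where $o(1)$ is a non-negative function of $n$ that tends to $0$ as $n\to\infty$ with $k$ and $\ell$ fixed. -/

import Mathlib

/-- The hypercube graph `Q_n`: the vertices are the binary sequences of length `n`, and two of them
are adjacent when they differ in exactly one position. -/
def hypercube (n : ℕ) : SimpleGraph (Fin n → Bool) where
  Adj x y := hammingDist x y = 1
  symm := ⟨fun x y h => by rw [hammingDist_comm]; exact h⟩
  loopless := ⟨fun x h => by simp at h⟩

/-- The generalized extremal function `ex(G, T, H)`: the maximum, over the `H`-free subgraphs `G'`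
of `G`, of the number of (unlabelled) copies of `T` in `G'`. Subgraphs are taken spanning; a deleted
vertex is the same as an isolated one, since `T` and `H` are graphs without isolated vertices. -/
noncomputable def genEx {V U W : Type*} [Fintype V]
    (G : SimpleGraph V) (T : SimpleGraph U) (H : SimpleGraph W) : ℕ :=
  sSup {m : ℕ | ∃ G' : SimpleGraph V, G' ≤ G ∧ H.Free G' ∧ m = G'.copyCount T}

/-- The supremum in the definition of `genEx` is over a finite set, hence it is a maximum as soon as
`G` has an `H`-free subgraph. -/
theorem genEx_set_finite {V U W : Type*} [Fintype V]
    (G : SimpleGraph V) (T : SimpleGraph U) (H : SimpleGraph W) :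
    {m : ℕ | ∃ G' : SimpleGraph V, G' ≤ G ∧ H.Free G' ∧ m = G'.copyCount T}.Finite := by
  refine (Set.finite_range (fun G' : SimpleGraph V => G'.copyCount T)).subset ?_
  rintro m ⟨G', -, -, rfl⟩
  exact ⟨G', rfl⟩

/-- The generalized Turán density `d(G, T, H) = ex(G, T, H) / N(G, T)`. -/
noncomputable def genTuranDensity {V U W : Type*} [Fintype V]
    (G : SimpleGraph V) (T : SimpleGraph U) (H : SimpleGraph W) : ℝ :=
  (genEx G T H : ℝ) / (G.copyCount T : ℝ)

/-- `z_{k,ℓ}`: the number of copies of `C_{2ℓ}` in `Q_k` whose edges use all `k` star positions,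
i.e. for every position `i` some edge of the copy joins two vertices that differ in position `i`. -/
noncomputable def starCycleCount (k l : ℕ) : ℕ :=
  {C : (hypercube k).Subgraph | Nonempty (SimpleGraph.cycleGraph (2 * l) ≃g C.coe) ∧
    ∀ i : Fin k, ∃ x y, C.Adj x y ∧ x i ≠ y i}.ncard

/-!
*Upper bound.* Since `Q_n` is edge transitive, double counting pairs of a copy of `T` and an edge
of it bounds the proportion of copies of `T` that survive in `G ⊆ Q_n` by the edge density of `G`.
It remains to find `C_{2k}` in a `G` of density `c n^{-1/16}`; one of `2k = 4m`, `2k = 4m + 6`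
holds for some `m ≥ 2`. Identify vertices with sets of positions, relative to a suitable origin.
On average over the origins, many triples `{x, u, v}` are joined in `G` to all their pairs, so two
positions `x ≠ x'` share many such `uv`. Dependent random choice finds, in the graph of these
`uv`, a cycle of length `2m` with a pendant edge. Its subdivision through the sets `{x, u}` and
`{x, u, v}` is a `C_{4m}`; subdividing with `x'` instead, and replacing a piece by a detour that
uses `x` and the pendant edge, gives a `C_{4m+6}`.

*Lower bound.* Parallel subcubes of dimension `⌈log₂ 2ℓ⌉`, with one `C_{2ℓ}` in each, form a graph
without `C_{2k}`. A `C_{2ℓ}` uses every star position at least twice, hence has at most `ℓ` of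
them, and it lies in the subcube that they span. The subcubes of dimension `ℓ` outnumber those of
dimension `ℓ - 1` by a factor of order `n`, so the copies with fewer than `ℓ` star positions are
negligible.
-/

open SimpleGraph Finset

section Density

variable {V V' W U : Type*}

/-- The set of unlabelled copies of `T` in `G`, which `SimpleGraph.copyCount` counts. -/
def copies (G : SimpleGraph V) (T : SimpleGraph W) : Set G.Subgraph :=
  {C | Nonempty (T ≃g C.coe)}

theorem copyCount_eq_ncard_copies [Fintype V] (G : SimpleGraph V) (T : SimpleGraph W) :
    G.copyCount T = (copies G T).ncard := by
  classical
  rw [copyCount, ← Set.ncard_coe_finset, coe_filter_univ, copies]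

theorem subgraph_map_injective {Q : SimpleGraph V} {Q' : SimpleGraph V'} {f : Q →g Q'}
    (hf : Function.Injective f) : Function.Injective (Subgraph.map f) := by
  intro C D h
  have hverts : f '' C.verts = f '' D.verts := congrArg Subgraph.verts h
  have hadj : Relation.Map C.Adj f f = Relation.Map D.Adj f f := congrArg Subgraph.Adj h
  refine Subgraph.ext (hf.image_injective hverts) ?_
  rw [← Relation.onFun_map_eq_of_injective hf (r := C.Adj), hadj,
    Relation.onFun_map_eq_of_injective hf]

theorem map_mem_copies_iff {Q : SimpleGraph V} {Q' : SimpleGraph V'} {T : SimpleGraph W}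
    (f : Copy Q Q') {C : Q.Subgraph} : C.map f.toHom ∈ copies Q' T ↔ C ∈ copies Q T :=
  ⟨fun h => h.map fun φ => φ.trans (f.isoSubgraphMap C).symm,
    fun h => h.map fun φ => φ.trans (f.isoSubgraphMap C)⟩

theorem toSubgraph_mem_copies {Q : SimpleGraph V} {T : SimpleGraph W} (f : Copy T Q) :
    f.toSubgraph ∈ copies Q T :=
  ⟨f.isoToSubgraph⟩

theorem verts_nonempty_of_mem_copies {Q : SimpleGraph V} {T : SimpleGraph W} [Nonempty W]
    {C : Q.Subgraph} (hC : C ∈ copies Q T) : C.verts.Nonempty :=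
  Set.nonempty_coe_sort.1 (‹Nonempty W›.map hC.some)

theorem connected_of_mem_copies {Q : SimpleGraph V} {T : SimpleGraph W} (hT : T.Connected)
    {C : Q.Subgraph} (hC : C ∈ copies Q T) : C.Connected :=
  ⟨hC.some.connected_iff.1 hT⟩

theorem ncard_edgeSet_of_mem_copies {Q : SimpleGraph V} {T : SimpleGraph W} {C : Q.Subgraph}
    (hC : C ∈ copies Q T) : C.edgeSet.ncard = T.edgeSet.ncard := by
  obtain ⟨φ⟩ := hC
  rw [← Subgraph.image_coe_edgeSet_coe,
    Set.ncard_image_of_injective _ (Sym2.map.injective Subtype.val_injective)]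
  exact (Nat.card_congr φ.mapEdgeSet).symm

/-- A graph is edge transitive if its automorphism group acts transitively on the (undirected)
edges. -/
def EdgeTransitive (Q : SimpleGraph V) : Prop :=
  ∀ e ∈ Q.edgeSet, ∀ e' ∈ Q.edgeSet, ∃ φ : Q ≃g Q, e.map φ = e'

theorem ncard_copies_through_le_of_map_eq [Finite V] {Q : SimpleGraph V} (T : SimpleGraph W)
    {e e' : Sym2 V} (φ : Q ≃g Q) (he : e.map φ = e') :
    {C ∈ copies Q T | e ∈ C.edgeSet}.ncard ≤ {C ∈ copies Q T | e' ∈ C.edgeSet}.ncard := by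
  refine Set.ncard_le_ncard_of_injOn (Subgraph.map φ.toHom) ?_
    (subgraph_map_injective φ.injective).injOn (Set.toFinite _)
  rintro C ⟨hC, heC⟩
  refine ⟨(map_mem_copies_iff φ.toCopy).2 hC, ?_⟩
  rw [Subgraph.edgeSet_map]
  exact ⟨e, heC, he⟩

theorem EdgeTransitive.exists_ncard_copies_through_eq [Finite V] {Q : SimpleGraph V}
    (hQ : EdgeTransitive Q) (T : SimpleGraph W) :
    ∃ ρ, ∀ e ∈ Q.edgeSet, {C ∈ copies Q T | e ∈ C.edgeSet}.ncard = ρ := by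
  rcases Q.edgeSet.eq_empty_or_nonempty with hE | ⟨e₀, he₀⟩
  · simp [hE]
  · refine ⟨{C ∈ copies Q T | e₀ ∈ C.edgeSet}.ncard, fun e he => ?_⟩
    obtain ⟨φ, hφ⟩ := hQ e he e₀ he₀
    obtain ⟨ψ, hψ⟩ := hQ e₀ he₀ e he
    exact (ncard_copies_through_le_of_map_eq T φ hφ).antisymm
      (ncard_copies_through_le_of_map_eq T ψ hψ)

theorem copyCount_le_ncard_copies_of_le [Fintype V] {G Q : SimpleGraph V} (hG : G ≤ Q)
    (T : SimpleGraph W) :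
    G.copyCount T ≤ {C ∈ copies Q T | C.edgeSet ⊆ G.edgeSet}.ncard := by
  rw [copyCount_eq_ncard_copies]
  refine Set.ncard_le_ncard_of_injOn (Subgraph.map (Hom.ofLE hG)) (fun C hC => ?_)
    (subgraph_map_injective Function.injective_id).injOn (Set.toFinite _)
  refine ⟨(map_mem_copies_iff (Copy.ofLE G Q hG)).2 hC, ?_⟩
  rw [Subgraph.edgeSet_map]
  rintro - ⟨e, he, rfl⟩
  simpa using C.edgeSet_subset he

/-- Double counting of the pairs `(C, e)` of a copy `C` of `T` in `Q` and an edge `e` of `C`: all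
edges of `Q` lie in equally many copies, and all copies have equally many edges. -/
theorem EdgeTransitive.copyCount_mul_ncard_edgeSet_le [Fintype V] [Finite W] {G Q : SimpleGraph V}
    (hQ : EdgeTransitive Q) (hG : G ≤ Q) {T : SimpleGraph W} (hT : T ≠ ⊥) :
    G.copyCount T * Q.edgeSet.ncard ≤ Q.copyCount T * G.edgeSet.ncard := by
  classical
  obtain ⟨ρ, hρ⟩ := hQ.exists_ncard_copies_through_eq T
  set N := {C ∈ copies Q T | C.edgeSet ⊆ G.edgeSet}.ncard
  have upper : N * T.edgeSet.ncard ≤ G.edgeSet.ncard * ρ := by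
    simp only [N, Set.ncard_eq_toFinset_card']
    refine card_mul_le_card_mul (fun C e => e ∈ C.edgeSet) (fun C hC => ?_) (fun e he => ?_)
    · obtain ⟨hC, hCG⟩ := Set.mem_toFinset.1 hC
      rw [← ncard_edgeSet_of_mem_copies hC, ← Set.ncard_coe_finset]
      exact Set.ncard_le_ncard fun e he => by simpa [bipartiteAbove, he] using hCG he
    · rw [← Set.ncard_coe_finset, ← hρ e (edgeSet_mono hG (Set.mem_toFinset.1 he))]
      exact Set.ncard_le_ncard fun C hC => by simp_all [bipartiteBelow]
  have lower : Q.edgeSet.ncard * ρ ≤ Q.copyCount T * T.edgeSet.ncard := by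
    rw [copyCount_eq_ncard_copies]
    simp only [Set.ncard_eq_toFinset_card']
    refine card_mul_le_card_mul' (fun C e => e ∈ C.edgeSet) (fun e he => ?_) (fun C hC => ?_)
    · rw [← Set.ncard_coe_finset, ← hρ e (Set.mem_toFinset.1 he)]
      exact Set.ncard_le_ncard fun C hC => by simp_all [bipartiteBelow]
    · rw [← ncard_edgeSet_of_mem_copies (Set.mem_toFinset.1 hC), ← Set.ncard_coe_finset]
      exact Set.ncard_le_ncard fun e he => by simp_all [bipartiteAbove]
  refine Nat.le_of_mul_le_mul_right ?_ ((Set.ncard_pos).2 (edgeSet_nonempty.2 hT))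
  calc G.copyCount T * Q.edgeSet.ncard * T.edgeSet.ncard
      ≤ N * T.edgeSet.ncard * Q.edgeSet.ncard := by
        rw [mul_right_comm]
        gcongr
        exact copyCount_le_ncard_copies_of_le hG T
    _ ≤ G.edgeSet.ncard * ρ * Q.edgeSet.ncard := by gcongr
    _ = Q.edgeSet.ncard * ρ * G.edgeSet.ncard := by ring
    _ ≤ Q.copyCount T * T.edgeSet.ncard * G.edgeSet.ncard := by gcongr
    _ = Q.copyCount T * G.edgeSet.ncard * T.edgeSet.ncard := by ring

theorem genTuranDensity_le_of_ncard_edgeSet_le [Fintype V] [Finite W] {Q : SimpleGraph V}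
    (hQ : EdgeTransitive Q) {T : SimpleGraph W} (hT : T ≠ ⊥) {H : SimpleGraph U} {δ : ℝ}
    (hδ : 0 ≤ δ) (h : ∀ G ≤ Q, H.Free G → (G.edgeSet.ncard : ℝ) ≤ δ * Q.edgeSet.ncard) :
    genTuranDensity Q T H ≤ δ := by
  have hcopies : ∀ G ≤ Q, H.Free G → (G.copyCount T : ℝ) ≤ δ * Q.copyCount T := by
    intro G hG hfree
    rcases Nat.eq_zero_or_pos (Q.edgeSet.ncard) with hE | hE
    · have hbot : Q = ⊥ := edgeSet_eq_empty.1 ((Set.ncard_eq_zero (Set.toFinite _)).1 hE)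
      obtain rfl : G = ⊥ := le_bot_iff.1 (hbot ▸ hG)
      rw [copyCount_eq_zero.2 (free_bot hT), Nat.cast_zero]
      positivity
    · refine le_of_mul_le_mul_right ?_ (Nat.cast_pos.2 hE : (0 : ℝ) < Q.edgeSet.ncard)
      calc (G.copyCount T * Q.edgeSet.ncard : ℝ)
          ≤ Q.copyCount T * G.edgeSet.ncard := mod_cast hQ.copyCount_mul_ncard_edgeSet_le hG hT
        _ ≤ Q.copyCount T * (δ * Q.edgeSet.ncard) := by gcongr; exact h G hG hfree
        _ = δ * Q.copyCount T * Q.edgeSet.ncard := by ring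
  have hex : genEx Q T H ≤ ⌊δ * Q.copyCount T⌋₊ := by
    refine csSup_le' ?_
    rintro m ⟨G, hG, hfree, rfl⟩
    exact Nat.le_floor (hcopies G hG hfree)
  exact div_le_of_le_mul₀ (by positivity) hδ
    ((Nat.cast_le.2 hex).trans (Nat.floor_le (by positivity)))

end Density

section Cycles

variable {V W : Type*} {G : SimpleGraph V}

theorem copy_surjective_of_isRegularOfDegree [Nonempty W] {T : SimpleGraph W} [T.LocallyFinite]
    [G.LocallyFinite] {d : ℕ} (hT : T.IsRegularOfDegree d) (hG : G.IsRegularOfDegree d)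
    (hconn : G.Preconnected) (f : Copy T G) : Function.Surjective f := by
  have neighbor_mem_range : ∀ w v, G.Adj (f w) v → ∃ w', f w' = v := by
    intro w v h
    have hcard : (T.neighborFinset w).map f.toEmbedding = G.neighborFinset (f w) := by
      refine eq_of_subset_of_card_le ?_ ?_
      · intro v' hv'
        obtain ⟨w', hw', rfl⟩ := mem_map.1 hv'
        exact (G.mem_neighborFinset _ _).2 (f.toHom.map_adj ((T.mem_neighborFinset _ _).1 hw'))
      · rw [card_map, card_neighborFinset_eq_degree, card_neighborFinset_eq_degree, hT, hG]
    obtain ⟨w', -, hw'⟩ := mem_map.1 (hcard ▸ (G.mem_neighborFinset _ _).2 h)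
    exact ⟨w', hw'⟩
  intro v
  obtain ⟨w₀⟩ := ‹Nonempty W›
  obtain ⟨p⟩ := hconn (f w₀) v
  generalize hu : f w₀ = u at p
  induction p generalizing w₀ with
  | nil => exact ⟨w₀, hu⟩
  | cons h _ ih =>
    obtain ⟨w₁, hw₁⟩ := neighbor_mem_range w₀ _ (hu ▸ h)
    exact ih w₁ hw₁

theorem eq_of_cycleGraph_isContained_cycleGraph {a b : ℕ} (ha : 3 ≤ a) (hb : 3 ≤ b)
    (h : cycleGraph a ⊑ cycleGraph b) : a = b := by
  obtain ⟨a, rfl⟩ := Nat.exists_eq_add_of_le' ha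
  obtain ⟨b, rfl⟩ := Nat.exists_eq_add_of_le' hb
  obtain ⟨f⟩ := h
  have hsurj := copy_surjective_of_isRegularOfDegree (d := 2)
    (fun _ => cycleGraph_degree_three_le) (fun _ => cycleGraph_degree_three_le)
    cycleGraph_preconnected f
  simpa using Fintype.card_of_bijective ⟨f.injective, hsurj⟩

theorem exists_cycleGraph_adj {N : ℕ} (hN : 2 ≤ N) (v : Fin N) : ∃ w, (cycleGraph N).Adj v w := by
  obtain ⟨N, rfl⟩ := Nat.exists_eq_add_of_le' hN
  exact ⟨v + 1, cycleGraph_adj.2 (Or.inr (add_sub_cancel_left v 1))⟩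

theorem cycleGraph_ne_bot {N : ℕ} (hN : 2 ≤ N) : cycleGraph N ≠ ⊥ :=
  ne_bot_iff_exists_adj.2 ⟨⟨0, by lia⟩, exists_cycleGraph_adj hN _⟩

theorem cons_isCycle_of_isPath {u v : V} {p : G.Walk u v} (hp : p.IsPath) (hadj : G.Adj v u)
    (hlen : 2 ≤ p.length) : (p.cons hadj).IsCycle :=
  Walk.isCycle_iff_isPath_tail_and_le_length.2 ⟨by simpa using hp, by simpa using hlen⟩

theorem cycleGraph_isContained_of_isPath {u v : V} {p : G.Walk u v} (hp : p.IsPath)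
    (hadj : G.Adj v u) {n : ℕ} (hn : 3 ≤ n) (hlen : p.length + 1 = n) : cycleGraph n ⊑ G :=
  (cycleGraph_isContained_iff hn).2
    ⟨v, p.cons hadj, cons_isCycle_of_isPath hp hadj (by lia), by rwa [Walk.length_cons]⟩

/-- A cyclic sequence of pairwise distinct vertices with consecutive terms adjacent, as a copy of a
cycle graph. -/
def cycleGraphCopy {n : ℕ} (f : Fin (n + 2) → V) (hf : Function.Injective f)
    (hadj : ∀ i, G.Adj (f i) (f (i + 1))) : Copy (cycleGraph (n + 2)) G where
  toHom := ⟨f, fun {i j} h => by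
    rcases cycleGraph_adj.1 h with h | h
    · rw [← sub_add_cancel i j, h, add_comm]
      exact (hadj j).symm
    · rw [← sub_add_cancel j i, h, add_comm]
      exact hadj i⟩
  injective' := hf

end Cycles

section DependentRandomChoice

variable {α : Type*} {B : SimpleGraph α}

theorem sum_ncard_comm {ι κ : Type*} [Fintype ι] [Fintype κ] (S : ι → Set κ) :
    ∑ i, (S i).ncard = ∑ k, {i | k ∈ S i}.ncard := by
  classical
  simpa [Set.ncard_eq_toFinset_card', bipartiteAbove, bipartiteBelow] using
    sum_card_bipartiteAbove_eq_sum_card_bipartiteBelow (s := univ) (t := univ) fun i k => k ∈ S i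

theorem sq_sum_ncard_le {ι κ : Type*} [Fintype ι] [Fintype κ] (S : ι → Set κ) :
    (∑ i, (S i).ncard) ^ 2 ≤ Fintype.card κ * ∑ q : ι × ι, (S q.1 ∩ S q.2).ncard := by
  have hfibre : ∀ k, {q : ι × ι | k ∈ S q.1 ∩ S q.2} = {i | k ∈ S i} ×ˢ {i | k ∈ S i} :=
    fun k => rfl
  calc (∑ i, (S i).ncard) ^ 2
      = (∑ k, {i | k ∈ S i}.ncard) ^ 2 := by rw [sum_ncard_comm]
    _ ≤ Fintype.card κ * ∑ k, {i | k ∈ S i}.ncard ^ 2 := sq_sum_le_card_mul_sum_sq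
    _ = Fintype.card κ * ∑ q : ι × ι, (S q.1 ∩ S q.2).ncard := by
        simp only [sum_ncard_comm, hfibre, Set.ncard_prod, sq]

/-- The pairs of distinct common neighbours of `q.1` and `q.2` that have themselves at most `s`
common neighbours. -/
def poorPairs (B : SimpleGraph α) (s : ℕ) (q : α × α) : Set (α × α) :=
  {p | p.1 ≠ p.2 ∧ (B.commonNeighbors p.1 p.2).ncard ≤ s ∧
    p.1 ∈ B.commonNeighbors q.1 q.2 ∧ p.2 ∈ B.commonNeighbors q.1 q.2}

theorem sum_ncard_poorPairs_le [Fintype α] (B : SimpleGraph α) (s : ℕ) :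
    ∑ q, (poorPairs B s q).ncard ≤ Fintype.card α ^ 2 * s ^ 2 := by
  have hfibre : ∀ p, {q | p ∈ poorPairs B s q}.ncard ≤ s ^ 2 := by
    intro p
    by_cases hp : (B.commonNeighbors p.1 p.2).ncard ≤ s
    · calc {q | p ∈ poorPairs B s q}.ncard
          ≤ (B.commonNeighbors p.1 p.2 ×ˢ B.commonNeighbors p.1 p.2).ncard := by
            refine Set.ncard_le_ncard fun q hq => ?_
            obtain ⟨-, -, h₁, h₂⟩ := hq
            exact ⟨⟨h₁.1.symm, h₂.1.symm⟩, ⟨h₁.2.symm, h₂.2.symm⟩⟩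
        _ ≤ s ^ 2 := by
            rw [Set.ncard_prod, sq]
            gcongr
    · have hempty : {q | p ∈ poorPairs B s q} = ∅ :=
        Set.eq_empty_of_forall_notMem fun q hq => hp hq.2.1
      simp [hempty]
  rw [sum_ncard_comm]
  simpa [sq] using sum_le_card_nsmul univ _ _ fun p _ => hfibre p

theorem exists_add_ncard_poorPairs_lt [Fintype α] (B : SimpleGraph α) {s m : ℕ}
    (hE : Fintype.card α ^ 3 * (m + s ^ 2) < (∑ z, (B.neighborSet z).ncard) ^ 2) :
    ∃ q, m + (poorPairs B s q).ncard < (B.commonNeighbors q.1 q.2).ncard := by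
  by_contra! hcon
  refine hE.not_ge ?_
  calc (∑ z, (B.neighborSet z).ncard) ^ 2
      ≤ Fintype.card α * ∑ q : α × α, (B.commonNeighbors q.1 q.2).ncard :=
        sq_sum_ncard_le B.neighborSet
    _ ≤ Fintype.card α * ∑ q : α × α, (m + (poorPairs B s q).ncard) := by
        gcongr with q
        exact hcon q
    _ ≤ Fintype.card α * (Fintype.card α ^ 2 * m + Fintype.card α ^ 2 * s ^ 2) := by
        rw [sum_add_distrib, sum_const, card_univ, Fintype.card_prod, smul_eq_mul, ← sq]
        gcongr
        exact sum_ncard_poorPairs_le B s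
    _ = Fintype.card α ^ 3 * (m + s ^ 2) := by ring

/-- Dependent random choice with two random vertices: remove from their common neighbourhood one
vertex of each poor pair. -/
theorem exists_finset_many_commonNeighbors [Fintype α] (B : SimpleGraph α)
    {s m : ℕ} (hE : Fintype.card α ^ 3 * (m + s ^ 2) < (∑ z, (B.neighborSet z).ncard) ^ 2) :
    ∃ U : Finset α, #U = m ∧ (U : Set α).Pairwise fun u w => s < (B.commonNeighbors u w).ncard := by
  obtain ⟨q, hq⟩ := exists_add_ncard_poorPairs_lt B hE
  set A := B.commonNeighbors q.1 q.2
  have hle : m ≤ (A \ Prod.fst '' poorPairs B s q).ncard := by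
    have h₁ := Set.le_ncard_sdiff (Prod.fst '' poorPairs B s q) A
    have h₂ := Set.ncard_image_le (f := Prod.fst) (poorPairs B s q).toFinite
    lia
  obtain ⟨U, hU, hUm⟩ := Set.exists_subset_card_eq hle
  refine ⟨U.toFinite.toFinset, ?_, fun u hu w hw huw => ?_⟩
  · rw [← Set.ncard_eq_toFinset_card, hUm]
  rw [Set.Finite.coe_toFinset] at hu hw
  by_contra! hs
  exact (hU hu).2 ⟨(u, w), ⟨huw, hs, (hU hu).1, (hU hw).1⟩, rfl⟩

theorem exists_mem_commonNeighbors_notMem {a b : α} {S : Finset α} {s : ℕ} (hS : #S ≤ s)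
    (hs : s < (B.commonNeighbors a b).ncard) : ∃ z ∉ S, B.Adj a z ∧ B.Adj b z := by
  obtain ⟨z, hz, hzS⟩ := Set.exists_mem_notMem_of_ncard_lt_ncard
    ((Set.ncard_coe_finset S).trans_le hS |>.trans_lt hs)
  exact ⟨z, hzS, hz⟩

theorem exists_isPath_alternating {U : Finset α}
    (hU : (U : Set α).Pairwise fun u w => 3 * #U < (B.commonNeighbors u w).ncard) {A : Finset α}
    (hA : A.Nonempty) (hAU : A ⊆ U) :
    ∃ a ∈ A, ∃ b ∈ A, ∃ p : B.Walk a b, p.IsPath ∧ p.length = 2 * (#A - 1) ∧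
      ∀ x ∈ p.support, x ∈ A ∨ x ∉ U := by
  classical
  induction hA using Finset.Nonempty.cons_induction with
  | singleton a => exact ⟨a, by simp, a, by simp, .nil, by simp⟩
  | cons x A hxA hA ih =>
    have hxU : x ∈ U := hAU (mem_cons_self x A)
    obtain ⟨a, ha, b, hb, p, hp, hlen, hsupp⟩ := ih ((subset_cons hxA).trans hAU)
    have haU : a ∈ U := hAU (mem_cons_of_mem ha)
    have hcard : #(U ∪ p.support.toFinset) ≤ 3 * #U := by
      have h₁ := card_union_le U p.support.toFinset
      have h₂ := p.support.toFinset_card_le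
      have h₃ := card_le_card hAU
      rw [Walk.length_support] at h₂
      rw [card_cons] at h₃
      have := hA.card_pos
      lia
    obtain ⟨z, hz, hxz, haz⟩ :=
      exists_mem_commonNeighbors_notMem hcard (hU hxU haU fun h => hxA (h ▸ ha))
    rw [mem_union, List.mem_toFinset, not_or] at hz
    have hxp : x ∉ p.support := fun h => (hsupp x h).elim hxA (· hxU)
    refine ⟨x, mem_cons_self x A, b, mem_cons_of_mem hb, .cons hxz (.cons haz.symm p), ?_, ?_, ?_⟩
    · simp [hp, hz.2, hxp, hxz.ne]
    · have := hA.card_pos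
      simp only [Walk.length_cons, hlen, card_cons]
      lia
    · intro y hy
      simp only [Walk.support_cons, List.mem_cons] at hy
      rcases hy with rfl | rfl | hy
      · exact Or.inl (mem_cons_self y A)
      · exact Or.inr hz.1
      · exact (hsupp y hy).imp_left mem_cons_of_mem

theorem exists_isCycle_with_pendant [Fintype α] (B : SimpleGraph α) {m : ℕ} (hm : 2 ≤ m)
    (hE : Fintype.card α ^ 3 * (m + (3 * m) ^ 2) < (∑ z, (B.neighborSet z).ncard) ^ 2) :
    ∃ (u : α) (c : B.Walk u u), c.IsCycle ∧ c.length = 2 * m ∧ ∃ y ∉ c.support, B.Adj u y := by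
  classical
  obtain ⟨U, rfl, hU⟩ := exists_finset_many_commonNeighbors B hE
  have hUne : U.Nonempty := card_pos.1 (by lia)
  obtain ⟨a, ha, b, hb, p, hp, hlen, -⟩ := exists_isPath_alternating hU hUne subset_rfl
  have hab : a ≠ b := by
    rintro rfl
    have := (Walk.isPath_iff_nil.1 hp).length_eq_zero
    lia
  have hcard : #p.support.toFinset ≤ 2 * #U - 1 := by
    have := p.support.toFinset_card_le
    rw [Walk.length_support] at this
    lia
  obtain ⟨z, hz, haz, hbz⟩ :=
    exists_mem_commonNeighbors_notMem (hcard.trans (by lia)) (hU ha hb hab)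
  obtain ⟨y, hy, -, hby⟩ := exists_mem_commonNeighbors_notMem
    ((card_insert_le z p.support.toFinset).trans (by lia)) (hU ha hb hab)
  rw [List.mem_toFinset] at hz
  simp only [mem_insert, List.mem_toFinset, not_or] at hy
  refine ⟨b, .cons hbz (.cons haz.symm p), cons_isCycle_of_isPath (hp.cons hz) hbz ?_, ?_,
    y, ?_, hby⟩
  · simp only [Walk.length_cons, hlen]
    lia
  · simp only [Walk.length_cons, hlen]
    lia
  · simp [hy, hby.ne']

end DependentRandomChoice

section FullLink

variable {α : Type*} [DecidableEq α] {H : SimpleGraph (Finset α)} {x : α}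

/-- The full link of `x` in a graph `H` on finite sets: `u` and `v` are adjacent when `{x, u, v}` is
a three-element set joined in `H` to each of its two-element subsets. A walk in the full link thus
has a subdivision in `H`, running through the sets `{x, u}` and `{x, u, v}`. -/
def fullLink (H : SimpleGraph (Finset α)) (x : α) : SimpleGraph α where
  Adj u v := (x ≠ u ∧ x ≠ v ∧ u ≠ v) ∧
    H.Adj {x, u, v} {x, u} ∧ H.Adj {x, u, v} {x, v} ∧ H.Adj {x, u, v} {u, v}
  symm := ⟨fun u v ⟨⟨hu, hv, huv⟩, h₁, h₂, h₃⟩ => by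
    rw [pair_comm u v] at h₁ h₂ h₃
    exact ⟨⟨hv, hu, huv.symm⟩, h₂, h₁, h₃⟩⟩
  loopless := ⟨fun _ h => h.1.2.2 rfl⟩

/-- The walk in `H` through the sets `{x, u}` and `{x, u, v}`, for the vertices `u` and the edges
`uv` of a walk in the full link of `x`. -/
def subdivide : ∀ {u v : α}, (fullLink H x).Walk u v → H.Walk {x, u} {x, v}
  | _, _, .nil => .nil
  | _, _, .cons h p => .cons h.2.1.symm (.cons h.2.2.1 (subdivide p))

theorem length_subdivide {u v : α} (p : (fullLink H x).Walk u v) :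
    (subdivide p).length = 2 * p.length := by
  induction p with
  | nil => rfl
  | cons h p ih => simp only [subdivide, Walk.length_cons, ih]; ring

theorem mem_of_mem_support_subdivide {u v : α} {p : (fullLink H x).Walk u v} {S : Finset α}
    (hS : S ∈ (subdivide p).support) : x ∈ S ∧ ∀ a ∈ S, a = x ∨ a ∈ p.support := by
  induction p with
  | nil => simp_all [subdivide]
  | cons h p ih =>
    simp only [subdivide, Walk.support_cons, List.mem_cons] at hS
    rcases hS with rfl | rfl | hS
    · simp
    · simp
    · exact ⟨(ih hS).1, fun a ha => ((ih hS).2 a ha).imp_right (List.mem_cons_of_mem _)⟩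

theorem mem_edges_of_mem_support_subdivide {u v : α} {p : (fullLink H x).Walk u v} {S : Finset α}
    (hS : S ∈ (subdivide p).support) {a b : α} (ha : a ∈ S) (hb : b ∈ S) (hab : a ≠ b)
    (hxa : x ≠ a) (hxb : x ≠ b) : s(a, b) ∈ p.edges := by
  induction p with
  | nil => grind [subdivide, Walk.support_nil]
  | cons h p ih =>
    simp only [subdivide, Walk.support_cons, List.mem_cons] at hS
    rw [Walk.edges_cons, List.mem_cons]
    rcases hS with rfl | rfl | hS
    · grind
    · left
      grind
    · exact Or.inr (ih hS)

theorem isPath_subdivide {u v : α} {p : (fullLink H x).Walk u v} (hp : p.IsPath) :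
    (subdivide p).IsPath := by
  induction p with
  | nil => exact .nil
  | @cons u w v h p ih =>
    obtain ⟨hp, hu⟩ := (Walk.cons_isPath_iff h p).1 hp
    have notMem : ∀ S : Finset α, u ∈ S → S ∉ (subdivide p).support := fun S huS hS =>
      ((mem_of_mem_support_subdivide hS).2 u huS).elim h.1.1.symm hu
    simp only [subdivide, Walk.cons_isPath_iff, Walk.support_cons, List.mem_cons, not_or]
    exact ⟨⟨ih hp, notMem _ (by simp)⟩, h.2.1.ne', notMem _ (by simp)⟩

theorem notMem_support_subdivide {u v : α} {p : (fullLink H x).Walk u v} {a b : α}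
    (h : (fullLink H x).Adj a b) (hab : s(a, b) ∉ p.edges) :
    {x, a, b} ∉ (subdivide p).support := fun hS =>
  hab (mem_edges_of_mem_support_subdivide hS (by simp) (by simp) h.1.2.2 h.1.1 h.1.2.1)

theorem cycleGraph_isContained_of_isCycle_fullLink {u : α} {c : (fullLink H x).Walk u u}
    (hc : c.IsCycle) : cycleGraph (2 * c.length) ⊑ H := by
  have hlen := hc.three_le_length
  cases c with
  | nil => exact absurd rfl hc.ne_nil
  | cons h p =>
    obtain ⟨hp, huv⟩ := (Walk.cons_isCycle_iff p h).1 hc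
    refine cycleGraph_isContained_of_isPath
      ((isPath_subdivide hp).cons (h := h.2.2.1) (notMem_support_subdivide h huv)) h.2.1.symm
      (by lia) ?_
    simp only [Walk.length_cons, length_subdivide]
    ring

/-- The subdivision of `p` is closed up through `{x', u, v}` and the detour
`{u, v}, {x, u, v}, {x, u}, {x, u, y}, {u, y}, {x', u, y}`. Every set on the subdivision contains
`x'` and not `y`, which keeps it disjoint from the detour. -/
theorem cycleGraph_isContained_of_isPath_fullLink {x' : α} (hx : x ≠ x') {u v y : α}
    (huv : (fullLink H x).Adj u v) (huy : (fullLink H x).Adj u y) (huv' : (fullLink H x').Adj u v)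
    (huy' : (fullLink H x').Adj u y) {p : (fullLink H x').Walk u v} (hp : p.IsPath)
    (huvp : s(u, v) ∉ p.edges) (hyp : y ∉ p.support) :
    cycleGraph (2 * p.length + 8) ⊑ H := by
  have mem_support : ∀ S ∈ (subdivide p).support, x' ∈ S ∧ y ∉ S := fun S hS =>
    ⟨(mem_of_mem_support_subdivide hS).1, fun hyS =>
      ((mem_of_mem_support_subdivide hS).2 y hyS).elim huy'.1.2.1.symm hyp⟩
  have hT := notMem_support_subdivide huv' huvp
  have hvy : v ≠ y := fun h => hyp (h ▸ p.end_mem_support)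
  let w : H.Walk {x', u, v} {x', v} :=
    .cons huv'.2.2.2 <| .cons huv.2.2.2.symm <| .cons huv.2.1 <| .cons huy.2.1.symm <|
      .cons huy.2.2.2 <| .cons huy'.2.2.2.symm <| .cons huy'.2.1 <| subdivide p
  have hw : w.IsPath := by
    simp only [w, Walk.cons_isPath_iff, Walk.support_cons, List.mem_cons, not_or]
    have x'_u_y_distinct := huy'.1
    have x_u_v_distinct := huv.1
    have x_u_y_distinct := huy.1
    have pair_ne := huv.2.1.ne
    have pair_ne' := huv'.2.2.2.ne
    refine ⟨⟨⟨⟨⟨⟨⟨isPath_subdivide hp, ?_⟩, ?_⟩, ?_⟩, ?_⟩, ?_⟩, ?_⟩, ?_⟩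
    all_goals grind
  refine cycleGraph_isContained_of_isPath hw huv'.2.2.1.symm (by lia) ?_
  simp only [w, Walk.length_cons, length_subdivide]

theorem cycleGraph_isContained_of_isCycle_inf_fullLink {x' : α} (hx : x ≠ x') {u : α}
    {c : (fullLink H x ⊓ fullLink H x').Walk u u} (hc : c.IsCycle) {y : α} (hy : y ∉ c.support)
    (huy : (fullLink H x ⊓ fullLink H x').Adj u y) : cycleGraph (2 * c.length + 6) ⊑ H := by
  cases c with
  | nil => exact absurd rfl hc.ne_nil
  | cons huv p =>
    obtain ⟨hp, huvp⟩ := (Walk.cons_isCycle_iff p huv).1 hc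
    have hlen : (p.reverse.mapLe (inf_le_right (a := fullLink H x))).length = p.length := by
      simp only [Walk.mapLe, Walk.length_map, Walk.length_reverse]
    rw [Walk.length_cons, mul_add, add_assoc, ← hlen]
    exact cycleGraph_isContained_of_isPath_fullLink hx huv.1 huy.1 huv.2 huy.2
      (hp.reverse.mapLe inf_le_right) (by simpa using huvp) (by simp_all)

end FullLink

section Hypercube

variable {n : ℕ} {G : SimpleGraph (Fin n → Bool)}

/-- The vertex of the hypercube obtained from `v` by flipping the coordinates in `K`. -/
def flipOn (v : Fin n → Bool) (K : Finset (Fin n)) : Fin n → Bool :=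
  fun i => xor (v i) (decide (i ∈ K))

theorem flipOn_injective (v : Fin n → Bool) : Function.Injective (flipOn v) := by
  intro K L h
  ext i
  simpa [flipOn] using congrFun h i

theorem flipOn_flipOn (v : Fin n → Bool) (K L : Finset (Fin n)) :
    flipOn (flipOn v K) L = flipOn v (symmDiff K L) := by
  funext i
  by_cases hK : i ∈ K <;> by_cases hL : i ∈ L <;> simp [flipOn, mem_symmDiff, hK, hL]

theorem flipOn_flipOn_self (v : Fin n → Bool) (K : Finset (Fin n)) :
    flipOn (flipOn v K) K = v := by
  funext i
  simp [flipOn]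

theorem hypercube_adj_iff {v w : Fin n → Bool} :
    (hypercube n).Adj v w ↔ ∃ i, flipOn v {i} = w := by
  change hammingDist v w = 1 ↔ _
  rw [hammingDist, card_eq_one]
  refine exists_congr fun i => ?_
  rw [Finset.ext_iff, funext_iff]
  refine forall_congr' fun j => ?_
  cases hv : v j <;> cases hw : w j <;> simp [flipOn, hv, hw]

/-- The automorphism of the hypercube that permutes the positions by `σ` and then flips those where
`c` is true. -/
def hypercubeIso (σ : Equiv.Perm (Fin n)) (c : Fin n → Bool) : hypercube n ≃g hypercube n where
  toFun v t := xor (v (σ t)) (c t)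
  invFun v t := xor (v (σ.symm t)) (c (σ.symm t))
  left_inv v := by simp
  right_inv v := by simp
  map_rel_iff' {v w} := by
    change hammingDist _ _ = 1 ↔ hammingDist v w = 1
    have hcard : hammingDist (fun t => xor (v (σ t)) (c t)) (fun t => xor (w (σ t)) (c t)) =
        hammingDist v w := card_equiv σ fun t => by simp
    rw [← hcard]
    rfl

theorem edgeTransitive_hypercube (n : ℕ) : EdgeTransitive (hypercube n) := by
  refine Sym2.ind fun u v huv => Sym2.ind fun u' v' huv' => ?_
  obtain ⟨i, rfl⟩ := hypercube_adj_iff.1 ((hypercube n).mem_edgeSet.1 huv)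
  obtain ⟨j, rfl⟩ := hypercube_adj_iff.1 ((hypercube n).mem_edgeSet.1 huv')
  refine ⟨hypercubeIso (Equiv.swap i j) fun t => xor (u (Equiv.swap i j t)) (u' t), ?_⟩
  refine congrArg₂ (fun x y => s(x, y)) (funext fun t => ?_) (funext fun t => ?_)
  · simp [hypercubeIso]
  · have ht : Equiv.swap i j t = i ↔ t = j := by simp [Equiv.swap_apply_eq_iff]
    have hxor : ∀ a b c : Bool, xor (xor a b) (xor a c) = xor c b := by decide
    simpa [hypercubeIso, flipOn, ht] using hxor _ _ _

/-- The positions that are flipped by the edges of `G` at `v`. -/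
def directions (G : SimpleGraph (Fin n → Bool)) (v : Fin n → Bool) : Set (Fin n) :=
  {i | G.Adj v (flipOn v {i})}

theorem sum_ncard_neighborSet {α : Type*} [Fintype α] (B : SimpleGraph α) :
    ∑ v, (B.neighborSet v).ncard = 2 * B.edgeSet.ncard := by
  classical
  rw [Set.ncard_eq_toFinset_card', ← edgeFinset, ← B.sum_degrees_eq_twice_card_edges]
  simp only [Set.ncard_eq_toFinset_card', Set.toFinset_card, card_neighborSet_eq_degree]

theorem sum_ncard_directions (hG : G ≤ hypercube n) :
    ∑ v, (directions G v).ncard = 2 * G.edgeSet.ncard := by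
  have hneighbors : ∀ v, G.neighborSet v = (fun i => flipOn v {i}) '' directions G v := by
    intro v
    ext w
    refine ⟨fun h => ?_, ?_⟩
    · obtain ⟨i, rfl⟩ := hypercube_adj_iff.1 (hG h)
      exact ⟨i, h, rfl⟩
    · rintro ⟨i, hi, rfl⟩
      exact hi
  have hinj : ∀ v : Fin n → Bool, Function.Injective fun i => flipOn v {i} := fun v =>
    (flipOn_injective v).comp (singleton_injective)
  simp only [← sum_ncard_neighborSet, hneighbors, Set.ncard_image_of_injective _ (hinj _)]

theorem two_mul_ncard_edgeSet_hypercube (n : ℕ) : 2 * (hypercube n).edgeSet.ncard = n * 2 ^ n := by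
  have hdir : ∀ v, directions (hypercube n) v = Set.univ := fun v =>
    Set.eq_univ_of_forall fun i => hypercube_adj_iff.2 ⟨i, rfl⟩
  rw [← sum_ncard_directions le_rfl]
  simp [hdir, mul_comm]

theorem fullLink_comap_flipOn_adj_iff {v : Fin n → Bool} {x : Fin n} {p : Fin n × Fin n} :
    (fullLink (G.comap (flipOn (flipOn v {x, p.1, p.2}))) x).Adj p.1 p.2 ↔
      (x ≠ p.1 ∧ x ≠ p.2 ∧ p.1 ≠ p.2) ∧
        p.2 ∈ directions G v ∧ p.1 ∈ directions G v ∧ x ∈ directions G v := by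
  refine and_congr_right fun h => ?_
  simp only [comap_adj, flipOn_flipOn, symmDiff_self]
  have h₀ : flipOn v ∅ = v := funext fun i => by simp [flipOn]
  have h₁ : symmDiff {x, p.1, p.2} {x, p.1} = ({p.2} : Finset (Fin n)) := by grind [mem_symmDiff]
  have h₂ : symmDiff {x, p.1, p.2} {x, p.2} = ({p.1} : Finset (Fin n)) := by grind [mem_symmDiff]
  have h₃ : symmDiff {x, p.1, p.2} {p.1, p.2} = ({x} : Finset (Fin n)) := by grind [mem_symmDiff]
  simp [h₀, h₁, h₂, h₃, directions]

theorem sum_ncard_distinct_triples {α : Type*} [Fintype α] (D : Set α) :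
    ∑ x, {p : α × α | (x ≠ p.1 ∧ x ≠ p.2 ∧ p.1 ≠ p.2) ∧ p.2 ∈ D ∧ p.1 ∈ D ∧ x ∈ D}.ncard =
      D.ncard.descFactorial 3 := by
  classical
  have hrow : ∀ x, {p : α × α | (x ≠ p.1 ∧ x ≠ p.2 ∧ p.1 ≠ p.2) ∧ p.2 ∈ D ∧ p.1 ∈ D ∧ x ∈ D}.ncard =
      if x ∈ D.toFinset then #(D.toFinset.erase x).offDiag else 0 := by
    intro x
    split_ifs with hx
    · rw [← Set.ncard_coe_finset]
      congr 1
      ext p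
      grind
    · simp_all
  simp only [hrow, sum_ite_mem, univ_inter, offDiag_card]
  rw [sum_congr rfl fun x hx => by rw [card_erase_of_mem hx], sum_const, smul_eq_mul,
    ← Set.ncard_eq_toFinset_card', ← Nat.mul_sub_one]
  simp [Nat.descFactorial_succ, mul_comm, mul_assoc, Nat.sub_sub]

/-- The triple `{x, u, w}` seen from `S` is a cube with opposite vertex `v = flipOn S {x, u, w}`,
and it is full exactly if the three edges at `v` belong to `G`. -/
theorem sum_sum_ncard_fullLink_comap (G : SimpleGraph (Fin n → Bool)) :
    ∑ S, ∑ x, {p : Fin n × Fin n | (fullLink (G.comap (flipOn S)) x).Adj p.1 p.2}.ncard =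
      ∑ v, (directions G v).ncard.descFactorial 3 := by
  simp only [← sum_ncard_distinct_triples]
  refine sum_comm.trans ((sum_congr rfl fun x _ => ?_).trans sum_comm)
  refine (sum_ncard_comm _).trans ((sum_congr rfl fun p _ => ?_).trans (sum_ncard_comm _).symm)
  have hinvol : Function.Involutive fun v => flipOn v {x, p.1, p.2} :=
    fun v => flipOn_flipOn_self v {x, p.1, p.2}
  refine (Set.ncard_congr (fun v _ => flipOn v {x, p.1, p.2}) (fun v hv => ?_)
    (fun v w _ _ h => hinvol.injective h) fun S hS => ?_).symm
  · exact fullLink_comap_flipOn_adj_iff.2 hv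
  · refine ⟨flipOn S {x, p.1, p.2}, ?_, flipOn_flipOn_self S _⟩
    refine fullLink_comap_flipOn_adj_iff.1 ?_
    rwa [flipOn_flipOn_self]

theorem exists_le_sum_ncard_fullLink {a : ℝ} (ha : 2 ≤ a)
    (hG : a * 2 ^ n ≤ ∑ v, ((directions G v).ncard : ℝ)) :
    ∃ S, (a - 2) ^ 3 ≤
      ∑ x, ({p : Fin n × Fin n | (fullLink (G.comap (flipOn S)) x).Adj p.1 p.2}.ncard : ℝ) := by
  have hcard : (#(univ : Finset (Fin n → Bool)) : ℝ) = 2 ^ n := by simp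
  have hsum : 2 ^ n * (a - 2) ≤ ∑ v, (((directions G v).ncard - 2 : ℕ) : ℝ) := by
    calc 2 ^ n * (a - 2) ≤ ∑ v, (((directions G v).ncard : ℝ) - 2) := by
          rw [sum_sub_distrib, sum_const, nsmul_eq_mul, hcard]
          linarith
      _ ≤ ∑ v, (((directions G v).ncard - 2 : ℕ) : ℝ) := by
          gcongr with v
          rw [sub_le_iff_le_add]
          exact_mod_cast le_tsub_add
  suffices h : ∑ _S : Fin n → Bool, (a - 2) ^ 3 ≤ ∑ S : Fin n → Bool,
      ∑ x, ({p : Fin n × Fin n | (fullLink (G.comap (flipOn S)) x).Adj p.1 p.2}.ncard : ℝ) by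
    simpa using exists_le_of_sum_le univ_nonempty h
  calc ∑ _S : Fin n → Bool, (a - 2) ^ 3
      = (2 ^ n * (a - 2)) ^ (2 + 1) / (2 ^ n) ^ 2 := by
        rw [sum_const, nsmul_eq_mul, hcard]
        field_simp
        ring
    _ ≤ (∑ v, (((directions G v).ncard - 2 : ℕ) : ℝ)) ^ (2 + 1) / (2 ^ n) ^ 2 := by
        have : 0 ≤ a - 2 := by linarith
        gcongr
    _ ≤ ∑ v, (((directions G v).ncard - 2 : ℕ) : ℝ) ^ (2 + 1) := by
        rw [← hcard]
        exact pow_sum_div_card_le_sum_pow (fun _ _ => Nat.cast_nonneg _) 2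
    _ ≤ ∑ v, ((directions G v).ncard.descFactorial 3 : ℝ) := by
        gcongr with v
        exact_mod_cast Nat.pow_sub_le_descFactorial _ 3
    _ = _ := mod_cast (sum_sum_ncard_fullLink_comap G).symm

end Hypercube

section UpperBound

theorem sum_sum_le_of_forall_ne {α : Type*} [Fintype α] {f : α × α → ℝ} {M : ℝ} (hM : 0 ≤ M)
    (hf : ∀ x x', x ≠ x' → f (x, x') ≤ M) :
    ∑ q, f q ≤ Fintype.card α ^ 2 * M + ∑ x, f (x, x) := by
  classical
  calc ∑ q, f q ≤ ∑ q : α × α, (M + if q.1 = q.2 then f (q.1, q.1) else 0) := by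
        refine sum_le_sum fun q _ => ?_
        obtain ⟨x, x'⟩ := q
        by_cases hx : x = x'
        · subst hx
          simpa using hM
        · simpa [hx] using hf x x' hx
    _ = Fintype.card α ^ 2 * M + ∑ x, f (x, x) := by
        simp [sum_add_distrib, Fintype.sum_prod_type, sq]

theorem exists_lt_ncard_inter {α β : Type*} [Fintype α] [Fintype β] (S : α → Set β) {M s : ℝ}
    (hM : 0 ≤ M) (hs : s ≤ ∑ x, ((S x).ncard : ℝ))
    (h : Fintype.card β * (Fintype.card α ^ 2 * M + s) < s ^ 2) (hβ : Fintype.card β ≤ s) :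
    ∃ x x', x ≠ x' ∧ M < (S x ∩ S x').ncard := by
  by_contra! hcon
  have hpairs : ∑ q : α × α, ((S q.1 ∩ S q.2).ncard : ℝ) ≤
      Fintype.card α ^ 2 * M + ∑ x, ((S x).ncard : ℝ) := by
    simpa using sum_sum_le_of_forall_ne (f := fun q => ((S q.1 ∩ S q.2).ncard : ℝ)) hM hcon
  have hsq : (∑ x, ((S x).ncard : ℝ)) ^ 2 ≤
      Fintype.card β * (Fintype.card α ^ 2 * M + ∑ x, ((S x).ncard : ℝ)) := by
    calc (∑ x, ((S x).ncard : ℝ)) ^ 2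
        ≤ Fintype.card β * ∑ q : α × α, ((S q.1 ∩ S q.2).ncard : ℝ) := mod_cast sq_sum_ncard_le S
      _ ≤ _ := by gcongr
  nlinarith

theorem ncard_eq_sum_ncard_fibre {α β : Type*} [Fintype α] [Finite β] (A : Set (α × β)) :
    A.ncard = ∑ a, {b | (a, b) ∈ A}.ncard := by
  rw [← Nat.card_coe_set_eq, Nat.card_congr (Equiv.setProdEquivSigma A), Nat.card_sigma]
  rfl

theorem cycleGraph_isContained_of_le_sum_ncard_fullLink {α : Type*} [Fintype α] [DecidableEq α]
    (H : SimpleGraph (Finset α)) {m : ℕ} (hm : 2 ≤ m) {M s : ℝ} (hM : 0 ≤ M)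
    (hMcard : (Fintype.card α : ℝ) ^ 3 * (m + (3 * m) ^ 2) ≤ M ^ 2)
    (hs : s ≤ ∑ x, ({p : α × α | (fullLink H x).Adj p.1 p.2}.ncard : ℝ))
    (hcard : (Fintype.card α : ℝ) ^ 2 * (Fintype.card α ^ 2 * M + s) < s ^ 2)
    (hcard' : (Fintype.card α : ℝ) ^ 2 ≤ s) :
    cycleGraph (4 * m) ⊑ H ∧ cycleGraph (4 * m + 6) ⊑ H := by
  obtain ⟨x, x', hx, hlt⟩ :=
    exists_lt_ncard_inter (fun x => {p : α × α | (fullLink H x).Adj p.1 p.2}) hM hs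
      (by simpa [sq] using hcard) (by simpa [sq] using hcard')
  have hdense : (Fintype.card α : ℝ) ^ 3 * (m + (3 * m) ^ 2) <
      (∑ u, (((fullLink H x ⊓ fullLink H x').neighborSet u).ncard : ℝ)) ^ 2 := by
    rw [ncard_eq_sum_ncard_fibre, Nat.cast_sum] at hlt
    exact hMcard.trans_lt (pow_lt_pow_left₀ hlt hM two_ne_zero)
  obtain ⟨u, c, hc, hlen, y, hy, huy⟩ :=
    exists_isCycle_with_pendant (fullLink H x ⊓ fullLink H x') hm (mod_cast hdense)
  have hlen' : 4 * m = 2 * c.length := by lia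
  refine ⟨?_, hlen' ▸ cycleGraph_isContained_of_isCycle_inf_fullLink hx hc hy huy⟩
  have := cycleGraph_isContained_of_isCycle_fullLink (hc.mapLe (inf_le_left (b := fullLink H x')))
  rwa [Walk.mapLe, Walk.length_map, ← hlen'] at this

theorem exists_two_mul_eq_four_mul_or {k : ℕ} (hk : 4 ≤ k) (hk5 : k ≠ 5) :
    ∃ m, 2 ≤ m ∧ (2 * k = 4 * m ∨ 2 * k = 4 * m + 6) := by
  obtain ⟨m, rfl | rfl⟩ := Nat.even_or_odd' k
  · exact ⟨m, by lia, by lia⟩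
  · exact ⟨m - 1, by lia, by lia⟩

/-- Here `a = 4mβ¹⁵` is a lower bound for the average degree. The full links in a suitable cube have
`(a - 2)³ ≥ a³ / 8` pairs of adjacent vertices in total, so two of them share more than `4mβ²⁴`. -/
theorem cycleGraph_isContained_of_average_degree {n m : ℕ} (hm : 2 ≤ m)
    {G : SimpleGraph (Fin n → Bool)} {β : ℝ} (hβ : 1 ≤ β) (hβn : β ^ 16 = n)
    (hG : 4 * m * β ^ 15 * 2 ^ n ≤ ∑ v, ((directions G v).ncard : ℝ)) :
    cycleGraph (4 * m) ⊑ G ∧ cycleGraph (4 * m + 6) ⊑ G := by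
  have hm' : (2 : ℝ) ≤ m := mod_cast hm
  have ha : 2 * (m * β ^ 15) ≤ 4 * m * β ^ 15 - 2 := by nlinarith [one_le_pow₀ hβ (n := 15)]
  obtain ⟨S, hS⟩ := exists_le_sum_ncard_fullLink (by nlinarith [one_le_pow₀ hβ (n := 15)]) hG
  have hm3 : (8 : ℝ) ≤ m ^ 3 := by
    calc (8 : ℝ) = 2 ^ 3 := by norm_num
      _ ≤ m ^ 3 := by gcongr
  have hs : 8 * m ^ 3 * β ^ 45 ≤ (4 * m * β ^ 15 - 2) ^ 3 := by
    calc 8 * m ^ 3 * β ^ 45 = (2 * (m * β ^ 15)) ^ 3 := by ring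
      _ ≤ (4 * m * β ^ 15 - 2) ^ 3 := by gcongr
  have hM : (n : ℝ) ^ 3 * (m + (3 * m) ^ 2) ≤ (4 * m * β ^ 24) ^ 2 := by
    calc (n : ℝ) ^ 3 * (m + (3 * m) ^ 2) = (m + 9 * m ^ 2) * β ^ 48 := by rw [← hβn]; ring
      _ ≤ 16 * m ^ 2 * β ^ 48 := by gcongr; nlinarith
      _ = (4 * m * β ^ 24) ^ 2 := by ring
  have hcard : (n : ℝ) ^ 2 * (n ^ 2 * (4 * m * β ^ 24) + 8 * m ^ 3 * β ^ 45) <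
      (8 * m ^ 3 * β ^ 45) ^ 2 := by
    calc (n : ℝ) ^ 2 * (n ^ 2 * (4 * m * β ^ 24) + 8 * m ^ 3 * β ^ 45)
        = 4 * m * β ^ 88 + 8 * m ^ 3 * β ^ 77 := by rw [← hβn]; ring
      _ ≤ 4 * m * β ^ 90 + 8 * m ^ 3 * β ^ 90 := by gcongr <;> first | exact hβ | norm_num
      _ = (4 * m + 8 * m ^ 3) * β ^ 90 := by ring
      _ < (64 * m ^ 3 * m ^ 3) * β ^ 90 := by gcongr; nlinarith
      _ = (8 * m ^ 3 * β ^ 45) ^ 2 := by ring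
  have hcard' : (n : ℝ) ^ 2 ≤ 8 * m ^ 3 * β ^ 45 := by
    calc (n : ℝ) ^ 2 = 1 * β ^ 32 := by rw [← hβn]; ring
      _ ≤ 8 * m ^ 3 * β ^ 45 := by gcongr <;> first | exact hβ | linarith
  have hcycles := cycleGraph_isContained_of_le_sum_ncard_fullLink (G.comap (flipOn S)) hm
    (M := 4 * m * β ^ 24) (by positivity) (by simpa using hM) (hs.trans hS) (by simpa using hcard)
    (by simpa using hcard')
  have hcomap : G.comap (flipOn S) ⊑ G :=
    ⟨(Embedding.comap ⟨flipOn S, flipOn_injective S⟩ G).toCopy⟩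
  exact hcycles.imp (·.trans hcomap) (·.trans hcomap)

theorem exists_ncard_edgeSet_le_of_free {k : ℕ} (hk : 4 ≤ k) (hk5 : k ≠ 5) :
    ∃ c : ℝ, 0 < c ∧ ∀ n, 0 < n → ∀ G ≤ hypercube n, (cycleGraph (2 * k)).Free G →
      (G.edgeSet.ncard : ℝ) ≤ c * (n : ℝ) ^ (-(1 / 16) : ℝ) * (hypercube n).edgeSet.ncard := by
  obtain ⟨m, hm, hmk⟩ := exists_two_mul_eq_four_mul_or hk hk5
  refine ⟨4 * m, by positivity, fun n hn G hG hfree => ?_⟩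
  have hn' : (1 : ℝ) ≤ n := mod_cast hn
  set β : ℝ := (n : ℝ) ^ (1 / 16 : ℝ) with hβ
  have hβ1 : 1 ≤ β := Real.one_le_rpow hn' (by norm_num)
  have hβn : β ^ 16 = n := by
    rw [hβ, ← Real.rpow_mul_natCast (by positivity)]
    norm_num
  by_contra! hcon
  have hG2 : ∑ v, ((directions G v).ncard : ℝ) = 2 * G.edgeSet.ncard :=
    mod_cast sum_ncard_directions hG
  have hQ2 : (2 * (hypercube n).edgeSet.ncard : ℝ) = n * 2 ^ n :=
    mod_cast two_mul_ncard_edgeSet_hypercube n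
  obtain ⟨h₁, h₂⟩ := cycleGraph_isContained_of_average_degree hm hβ1 hβn (G := G) <| by
    calc 4 * m * β ^ 15 * 2 ^ n = 4 * m * β⁻¹ * (n * 2 ^ n) := by
          rw [← hβn]
          field_simp
      _ = 2 * (4 * m * (n : ℝ) ^ (-(1 / 16) : ℝ) * (hypercube n).edgeSet.ncard) := by
          rw [← hQ2, Real.rpow_neg (by positivity)]
          ring
      _ ≤ ∑ v, ((directions G v).ncard : ℝ) := by
          rw [hG2]
          gcongr
  rcases hmk with h | h
  · exact hfree (h ▸ h₁)
  · exact hfree (h ▸ h₂)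

theorem exists_genTuranDensity_le {k : ℕ} (hk : 4 ≤ k) (hk5 : k ≠ 5) :
    ∃ c : ℝ, 0 < c ∧ ∀ n, 0 < n → ∀ {W : Type*} [Finite W] {T : SimpleGraph W}, T ≠ ⊥ →
      genTuranDensity (hypercube n) T (cycleGraph (2 * k)) ≤ c * (n : ℝ) ^ (-(1 / 16) : ℝ) := by
  obtain ⟨c, hc, h⟩ := exists_ncard_edgeSet_le_of_free hk hk5
  exact ⟨c, hc, fun n hn W _ T hT => genTuranDensity_le_of_ncard_edgeSet_le
    (edgeTransitive_hypercube n) hT (by positivity) (h n hn)⟩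

end UpperBound

section GrayCode

variable {q : ℕ}

theorem hammingDist_cons (b b' : Bool) (x y : Fin q → Bool) :
    hammingDist (Fin.cons b x : Fin (q + 1) → Bool) (Fin.cons b' y) =
      (if b = b' then 0 else 1) + hammingDist x y := by
  simp [hammingDist, Fin.card_filter_univ_succ']

/-- The face of the hypercube on which the first position is constantly `b`. -/
def face (q : ℕ) (b : Bool) : hypercube q ↪g hypercube (q + 1) where
  toFun x := (Fin.cons b x : Fin (q + 1) → Bool)
  inj' := Fin.cons_right_injective (α := fun _ => Bool) b
  map_rel_iff' {x y} := by
    change hammingDist (Fin.cons b x : Fin (q + 1) → Bool) (Fin.cons b y) = 1 ↔ hammingDist x y = 1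
    rw [hammingDist_cons, if_pos rfl, zero_add]

theorem hypercube_adj_face {b b' : Bool} (hb : b ≠ b') (x : Fin q → Bool) :
    (hypercube (q + 1)).Adj (face q b x) (face q b' x) :=
  (hammingDist_cons b b' x x).trans (by rw [if_neg hb, hammingDist_self])

theorem face_ne_face {b b' : Bool} (hb : b ≠ b') (x y : Fin q → Bool) : face q b x ≠ face q b' y :=
  fun h => hb (Fin.cons_inj (α := fun _ => Bool).1 h).1

/-- The walk `p` in one face of the cube, followed by its reverse in the opposite face. -/
def ladder {x y : Fin q → Bool} (p : (hypercube q).Walk x y) :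
    (hypercube (q + 1)).Walk (face q false x) (face q true x) :=
  (p.map (face q false).toHom).append
    ((p.map (face q true).toHom).reverse.cons (hypercube_adj_face Bool.false_ne_true y))

theorem length_ladder {x y : Fin q → Bool} (p : (hypercube q).Walk x y) :
    (ladder p).length = 2 * p.length + 1 := by
  simp [ladder]
  ring

theorem isPath_ladder {x y : Fin q → Bool} {p : (hypercube q).Walk x y} (hp : p.IsPath) :
    (ladder p).IsPath := by
  have hmap : ∀ b, (p.support.map (face q b)).Nodup :=
    fun b => hp.support_nodup.map (face q b).injective
  rw [Walk.isPath_def, ladder, Walk.support_append, Walk.support_cons, List.tail_cons,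
    Walk.support_reverse, Walk.support_map, Walk.support_map, List.nodup_append']
  refine ⟨hmap false, List.nodup_reverse.2 (hmap true), ?_⟩
  simp [List.disjoint_left, face_ne_face]

theorem exists_isPath_hypercube {q L : ℕ} (hL : L < 2 ^ q) :
    ∃ (x y : Fin q → Bool) (p : (hypercube q).Walk x y), p.IsPath ∧ p.length = L := by
  suffices hamiltonian : ∀ q, ∃ (x y : Fin q → Bool) (p : (hypercube q).Walk x y),
      p.IsPath ∧ p.length + 1 = 2 ^ q by
    obtain ⟨x, y, p, hp, hlen⟩ := hamiltonian q
    exact ⟨x, _, p.take L, hp.take L, by rw [Walk.take_length]; lia⟩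
  intro q
  induction q with
  | zero => exact ⟨default, default, .nil, .nil, rfl⟩
  | succ q ih =>
    obtain ⟨x, y, p, hp, hlen⟩ := ih
    exact ⟨_, _, ladder p, isPath_ladder hp, by rw [length_ladder, pow_succ]; lia⟩

theorem cycleGraph_isContained_hypercube {l q : ℕ} (hl : 2 ≤ l) (h : 2 * l ≤ 2 ^ q) :
    cycleGraph (2 * l) ⊑ hypercube q := by
  cases q with
  | zero => lia
  | succ q =>
    rw [pow_succ] at h
    obtain ⟨x, y, p, hp, hlen⟩ := exists_isPath_hypercube (q := q) (L := l - 1) (by lia)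
    exact cycleGraph_isContained_of_isPath (isPath_ladder hp)
      (hypercube_adj_face Bool.false_ne_true.symm x) (by lia) (by rw [length_ladder]; lia)

end GrayCode

section StarCycle

/-- The `j`-th vertex of the cycle of length `2 l` in `Q_l` that starts at the zero vertex and flips
the positions `0, …, l - 1, 0, …, l - 1` in this order. -/
def starCycle (l j : ℕ) : Fin l → Bool :=
  fun i => decide (i < j ∧ j ≤ i + l)

theorem flipOn_starCycle {l j : ℕ} (i : Fin l) (hi : j = i ∨ j = i + l) :
    flipOn (starCycle l j) {i} = starCycle l (if j + 1 = 2 * l then 0 else j + 1) := by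
  funext t
  rw [Bool.eq_iff_iff]
  simp only [starCycle, flipOn, mem_singleton, Fin.ext_iff, bne_iff_ne, ne_eq, decide_eq_decide,
    decide_eq_true_eq]
  split_ifs <;> lia

theorem starCycle_injOn (l : ℕ) : Set.InjOn (starCycle l) (Set.Iio (2 * l)) := by
  have starCycle_ne : ∀ {j j'}, j < j' → j' < 2 * l → starCycle l j ≠ starCycle l j' := by
    intro j j' hlt hj' h
    have separate : ∀ i, i < l → ((i < j ∧ j ≤ i + l) ↔ (i < j' ∧ j' ≤ i + l)) :=
      fun i hi => decide_eq_decide.1 (congrFun h ⟨i, hi⟩)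
    rcases lt_or_ge j l with hj | hj
    · have := separate j hj
      have := separate (l - 1) (by lia)
      lia
    · have := separate (j - l) (by lia)
      lia
  intro j hj j' hj' h
  rcases lt_trichotomy j j' with hlt | heq | hlt
  · exact absurd h (starCycle_ne hlt hj')
  · exact heq
  · exact absurd h.symm (starCycle_ne hlt hj)

theorem flipOn_starCycle_val {p : ℕ} (j : Fin (2 * p + 2 + 2)) (i : Fin (p + 2))
    (hi : (j : ℕ) = i ∨ (j : ℕ) = i + (p + 2)) :
    flipOn (starCycle (p + 2) j) {i} = starCycle (p + 2) (j + 1 : Fin (2 * p + 2 + 2)) := by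
  rw [flipOn_starCycle i hi, Fin.val_add_one]
  congr 1
  simp only [Fin.ext_iff, Fin.val_last]
  split_ifs <;> lia

/-- `starCycle` as a copy of a cycle graph in the hypercube. -/
def starCycleCopy (p : ℕ) : Copy (cycleGraph (2 * p + 2 + 2)) (hypercube (p + 2)) :=
  cycleGraphCopy (fun j => starCycle (p + 2) j)
    (fun j j' h => Fin.ext (starCycle_injOn (p + 2) (Set.mem_Iio.2 (by lia))
      (Set.mem_Iio.2 (by lia)) h))
    fun j => hypercube_adj_iff.2 <| by
      rcases lt_or_ge (j : ℕ) (p + 2) with hj | hj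
      · exact ⟨⟨j, hj⟩, flipOn_starCycle_val j _ (Or.inl rfl)⟩
      · exact ⟨⟨j - (p + 2), by lia⟩, flipOn_starCycle_val j _ (Or.inr (by simp; lia))⟩

theorem starCycleCount_pos {l : ℕ} (hl : 2 ≤ l) : 0 < starCycleCount l l := by
  obtain ⟨p, rfl⟩ := Nat.exists_eq_add_of_le' hl
  rw [starCycleCount, Set.ncard_pos (Set.toFinite _)]
  refine ⟨(starCycleCopy p).toSubgraph, toSubgraph_mem_copies _, fun i => ?_⟩
  let j : Fin (2 * p + 2 + 2) := ⟨i, by lia⟩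
  refine ⟨starCycleCopy p j, starCycleCopy p (j + 1), ?_, ?_⟩
  · rw [Subgraph.map_adj]
    exact ⟨j, j + 1, cycleGraph_adj.2 (Or.inr (add_sub_cancel_left j 1)), rfl, rfl⟩
  · change starCycle _ _ i ≠ starCycle _ (j + 1 : Fin _) i
    rw [← flipOn_starCycle_val j i (Or.inl rfl)]
    simp [flipOn]

end StarCycle

section Subcubes

variable {s n : ℕ} {e : Fin s ↪ Fin n}

theorem hammingDist_extend (e : Fin s ↪ Fin n) (z z' : Fin s → Bool) (b : Fin n → Bool) :
    hammingDist (Function.extend e z b) (Function.extend e z' b) = hammingDist z z' := by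
  rw [hammingDist, hammingDist, ← card_map e]
  congr 1
  ext i
  by_cases hi : ∃ t, e t = i
  · obtain ⟨t, rfl⟩ := hi
    simp [e.injective.extend_apply]
  · have : ∀ t, e t ≠ i := not_exists.1 hi
    simp [this]

/-- The subcube through `b` whose free positions are those in the range of `e`. -/
noncomputable def subcube (e : Fin s ↪ Fin n) (b : Fin n → Bool) : hypercube s ↪g hypercube n where
  toFun z := Function.extend e z b
  inj' := Function.extend_injective e.injective b
  map_rel_iff' := by simp [hypercube, hammingDist_extend]

theorem subcube_apply_embedding (b : Fin n → Bool) (z : Fin s → Bool) (t : Fin s) :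
    subcube e b z (e t) = z t :=
  e.injective.extend_apply z b t

theorem subcube_apply_of_notMem (b : Fin n → Bool) (z : Fin s → Bool) {i : Fin n}
    (hi : i ∉ Set.range e) : subcube e b z i = b i :=
  Function.extend_apply' z b i hi

theorem subcube_comp (b : Fin n → Bool) (z : Fin s → Bool) : subcube e b z ∘ e = z :=
  funext (subcube_apply_embedding b z)

theorem subcube_apply_comp {x b : Fin n → Bool} (h : ∀ i ∉ Set.range e, x i = b i) :
    subcube e b (x ∘ e) = x := by
  funext i
  by_cases hi : i ∈ Set.range e
  · obtain ⟨t, rfl⟩ := hi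
    exact subcube_apply_embedding b _ t
  · rw [subcube_apply_of_notMem b _ hi, h i hi]

theorem subcube_congr {b b' : Fin n → Bool} (h : ∀ i ∉ Set.range e, b i = b' i) :
    subcube e b = subcube e b' := by
  refine RelEmbedding.ext fun z => ?_
  rw [← subcube_apply_comp (x := subcube e b z) (b := b') fun i hi => ?_, subcube_comp]
  rw [subcube_apply_of_notMem b z hi, h i hi]

theorem card_fixedPositions (e : Fin s ↪ Fin n) :
    Nat.card (↥(Set.range e)ᶜ → Bool) = 2 ^ (n - s) := by
  rw [Nat.card_fun, Nat.card_coe_set_eq, Set.ncard_compl, Set.ncard_range_of_injective e.injective]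
  simp

/-- The vertex that takes the values `v` at the positions outside the range of `e`; these vertices
represent the subcubes with free positions `e`. -/
noncomputable def baseVertex (v : ↥(Set.range e)ᶜ → Bool) : Fin n → Bool :=
  Function.extend Subtype.val v default

theorem baseVertex_apply (v : ↥(Set.range e)ᶜ → Bool) (i : ↥(Set.range e)ᶜ) :
    baseVertex v i = v i :=
  Subtype.val_injective.extend_apply v _ i

theorem subcube_baseVertex (b : Fin n → Bool) :
    subcube e (baseVertex (e := e) fun i => b i) = subcube e b :=
  subcube_congr fun i hi => baseVertex_apply (fun i => b i) ⟨i, hi⟩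

/-- The graph that has a copy of `K` in each of the subcubes with free positions `e`. -/
def parallelCopies (e : Fin s ↪ Fin n) (K : SimpleGraph (Fin s → Bool)) :
    SimpleGraph (Fin n → Bool) where
  Adj x y := (∀ i ∉ Set.range e, x i = y i) ∧ K.Adj (x ∘ e) (y ∘ e)
  symm := ⟨fun _ _ h => ⟨fun i hi => (h.1 i hi).symm, h.2.symm⟩⟩
  loopless := ⟨fun _ h => h.2.ne rfl⟩

variable {K : SimpleGraph (Fin s → Bool)} {U W : Type*} {T : SimpleGraph W} {H : SimpleGraph U}

theorem parallelCopies_le (hK : K ≤ hypercube s) : parallelCopies e K ≤ hypercube n := by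
  intro x y h
  have hadj := (subcube e y).map_adj_iff.2 (hK h.2)
  rwa [subcube_apply_comp h.1, subcube_apply_comp fun i _ => rfl] at hadj

theorem eq_of_reachable_parallelCopies {x y : Fin n → Bool}
    (h : (parallelCopies e K).Reachable x y) {i : Fin n} (hi : i ∉ Set.range e) : x i = y i := by
  obtain ⟨p⟩ := h
  induction p with
  | nil => rfl
  | cons hadj _ ih => exact (hadj.1 i hi).trans ih

theorem free_parallelCopies (hH : H.Preconnected) (hfree : H.Free K) :
    H.Free (parallelCopies e K) := by
  rintro ⟨g⟩
  refine hfree ⟨⟨⟨fun u => g u ∘ e, fun h => (g.toHom.map_adj h).2⟩, fun u u' h => ?_⟩⟩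
  refine g.injective ?_
  change g u = g u'
  have hbase : ∀ i ∉ Set.range e, g u i = g u' i :=
    fun i hi => eq_of_reachable_parallelCopies ((hH u u').map g.toHom) hi
  have h : g u ∘ e = g u' ∘ e := h
  rw [← subcube_apply_comp hbase, h, subcube_apply_comp fun i _ => rfl]

/-- The copy of `K` in the subcube through `b`. -/
noncomputable def parallelCopy (e : Fin s ↪ Fin n) (K : SimpleGraph (Fin s → Bool))
    (b : Fin n → Bool) : Copy K (parallelCopies e K) where
  toHom := ⟨subcube e b, fun {z z'} h =>
    ⟨fun i hi => by rw [subcube_apply_of_notMem b z hi, subcube_apply_of_notMem b z' hi],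
      by rwa [subcube_comp, subcube_comp]⟩⟩
  injective' := (subcube e b).injective

theorem map_parallelCopy_injOn :
    Set.InjOn (fun q : (↥(Set.range e)ᶜ → Bool) × K.Subgraph =>
      q.2.map (parallelCopy e K (baseVertex q.1)).toHom) {q | q.2.verts.Nonempty} := by
  rintro ⟨v, C⟩ ⟨z, hz⟩ ⟨v', C'⟩ - h
  replace h : C.map (parallelCopy e K (baseVertex v)).toHom =
    C'.map (parallelCopy e K (baseVertex v')).toHom := h
  have hz' : parallelCopy e K (baseVertex v) z ∈
      (C'.map (parallelCopy e K (baseVertex v')).toHom).verts := by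
    rw [← h]
    exact ⟨z, hz, rfl⟩
  obtain ⟨z', -, hzz'⟩ := hz'
  have hvv' : v = v' := by
    funext i
    have hi : subcube e (baseVertex v') z' i = subcube e (baseVertex v) z i := congrFun hzz' i
    rwa [subcube_apply_of_notMem _ _ i.2, subcube_apply_of_notMem _ _ i.2, baseVertex_apply,
      baseVertex_apply, eq_comm] at hi
  subst hvv'
  exact congrArg (Prod.mk v) (subgraph_map_injective (parallelCopy e K (baseVertex v)).injective h)

theorem two_pow_mul_copyCount_le_copyCount_parallelCopies [Nonempty W] (e : Fin s ↪ Fin n)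
    (K : SimpleGraph (Fin s → Bool)) (T : SimpleGraph W) :
    2 ^ (n - s) * K.copyCount T ≤ (parallelCopies e K).copyCount T := by
  rw [copyCount_eq_ncard_copies, copyCount_eq_ncard_copies, ← card_fixedPositions e,
    ← Set.ncard_univ, ← Set.ncard_prod]
  exact Set.ncard_le_ncard_of_injOn _ (fun q hq => (map_mem_copies_iff _).2 hq.2)
    (map_parallelCopy_injOn.mono fun q hq => verts_nonempty_of_mem_copies hq.2) (Set.toFinite _)

theorem two_pow_mul_copyCount_le_genEx [Nonempty W] (hsn : s ≤ n) (hK : K ≤ hypercube s)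
    (hH : H.Preconnected) (hfree : H.Free K) :
    2 ^ (n - s) * K.copyCount T ≤ genEx (hypercube n) T H :=
  (two_pow_mul_copyCount_le_copyCount_parallelCopies (Fin.castLEEmb hsn) K T).trans <|
    le_csSup (genEx_set_finite _ _ _).bddAbove
      ⟨_, parallelCopies_le hK, free_parallelCopies hH hfree, rfl⟩

theorem isContained_of_isContained_map {V : Type*} {f : W ↪ V} (hH : ∀ u, ∃ u', H.Adj u u')
    (h : H ⊑ T.map f) : H ⊑ T := by
  obtain ⟨g⟩ := h
  have mem_range : ∀ u, ∃ w, f w = g u := by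
    intro u
    obtain ⟨u', hu'⟩ := hH u
    obtain ⟨-, w, w', -, hw, -⟩ := g.toHom.map_adj hu'
    exact ⟨w, hw⟩
  choose k hk using mem_range
  refine ⟨⟨⟨k, fun {u u'} h => ?_⟩, fun u u' h => g.injective ?_⟩⟩
  · rw [← T.map_adj_apply (f := f), hk, hk]
    exact g.toHom.map_adj h
  · exact (hk u).symm.trans ((congrArg f h).trans (hk u'))

theorem two_pow_le_genEx_cycleGraph {k l : ℕ} (hk : 2 ≤ k) (hl : 2 ≤ l) (hlk : l ≠ k)
    (hs : 2 * l ≤ 2 ^ s) (hsn : s ≤ n) :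
    2 ^ (n - s) ≤ genEx (hypercube n) (cycleGraph (2 * l)) (cycleGraph (2 * k)) := by
  obtain ⟨f⟩ := cycleGraph_isContained_hypercube hl hs
  have : Nonempty (Fin (2 * l)) := ⟨⟨0, by lia⟩⟩
  have hle : (cycleGraph (2 * l)).map f.toEmbedding ≤ hypercube s := by
    rw [SimpleGraph.map_le_iff_le_comap]
    exact fun _ _ h => f.toHom.map_adj h
  have hfree : (cycleGraph (2 * k)).Free ((cycleGraph (2 * l)).map f.toEmbedding) := fun h => by
    have := eq_of_cycleGraph_isContained_cycleGraph (by lia) (by lia)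
      (isContained_of_isContained_map (exists_cycleGraph_adj (by lia)) h)
    lia
  have hpos : 0 < ((cycleGraph (2 * l)).map f.toEmbedding).copyCount (cycleGraph (2 * l)) :=
    copyCount_pos.2 ⟨(SimpleGraph.Embedding.map f.toEmbedding _).toCopy⟩
  exact (Nat.le_mul_of_pos_right _ hpos).trans
    (two_pow_mul_copyCount_le_genEx hsn hle cycleGraph_preconnected hfree)

end Subcubes

section StarPositions

variable {s n : ℕ}

/-- The star positions of the edges of a subgraph of the hypercube. -/
def starPositions (C : (hypercube n).Subgraph) : Set (Fin n) :=
  {i | ∃ x y, C.Adj x y ∧ x i ≠ y i}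

theorem mem_starPositions_of_embedding_mem {e : Fin s ↪ Fin n} {b : Fin n → Bool}
    {C : (hypercube s).Subgraph} {t : Fin s}
    (ht : e t ∈ starPositions (C.map (subcube e b).toHom)) : t ∈ starPositions C := by
  obtain ⟨-, -, ⟨z, z', hzz', rfl, rfl⟩, hne⟩ := ht
  have hne : subcube e b z (e t) ≠ subcube e b z' (e t) := hne
  rw [subcube_apply_embedding, subcube_apply_embedding] at hne
  exact ⟨z, z', hzz', hne⟩

theorem eq_of_notMem_starPositions {C : (hypercube n).Subgraph} (hC : C.Connected) {i : Fin n}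
    (hi : i ∉ starPositions C) {x y : Fin n → Bool} (hx : x ∈ C.verts) (hy : y ∈ C.verts) :
    x i = y i := by
  suffices h : ∀ u v : C.verts, C.coe.Walk u v → u.1 i = v.1 i by
    obtain ⟨p⟩ := hC.coe.preconnected ⟨x, hx⟩ ⟨y, hy⟩
    exact h _ _ p
  intro u v p
  induction p with
  | nil => rfl
  | cons hadj _ ih =>
    refine Eq.trans ?_ ih
    by_contra hne
    exact hi ⟨_, _, hadj, hne⟩

theorem exists_eq_map_subcube {e : Fin s ↪ Fin n} {C : (hypercube n).Subgraph} (hC : C.Connected)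
    (he : starPositions C ⊆ Set.range e) :
    ∃ (b : Fin n → Bool) (C' : (hypercube s).Subgraph), C'.map (subcube e b).toHom = C := by
  obtain ⟨b, hb⟩ := hC.nonempty
  have subcube_comp_eq : ∀ x ∈ C.verts, (subcube e b).toHom (x ∘ e) = x := fun x hx =>
    subcube_apply_comp fun i hi => eq_of_notMem_starPositions hC (fun h => hi (he h)) hx hb
  refine ⟨b, C.comap (subcube e b).toHom, Subgraph.ext ?_ ?_⟩
  · ext x
    exact ⟨fun ⟨_, hz, hzx⟩ => hzx ▸ hz, fun hx =>
      ⟨x ∘ e, by rwa [Subgraph.comap_verts, Set.mem_preimage, subcube_comp_eq x hx],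
        subcube_comp_eq x hx⟩⟩
  · ext x y
    refine ⟨fun ⟨z, z', hzz', hx, hy⟩ => hx ▸ hy ▸ hzz'.2, fun hxy => ?_⟩
    have hx := subcube_comp_eq x hxy.fst_mem
    have hy := subcube_comp_eq y hxy.snd_mem
    refine ⟨x ∘ e, y ∘ e, ⟨(subcube e b).map_adj_iff.1 ?_, by rwa [hx, hy]⟩, hx, hy⟩
    exact hx.symm ▸ hy.symm ▸ hxy.adj_sub

theorem card_orderEmbedding_fin (s n : ℕ) : Nat.card (Fin s ↪o Fin n) = n.choose s := by
  rw [Nat.card_congr Set.powersetCard.ofFinEmbEquiv, Set.powersetCard.card, Nat.card_fin]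

theorem exists_orderEmbedding_subset_range {S : Set (Fin n)} (hS : S.ncard ≤ s) (hsn : s ≤ n) :
    ∃ e : Fin s ↪o Fin n, S ⊆ Set.range e := by
  classical
  obtain ⟨J, hSJ, hJ⟩ := Finset.exists_superset_card_eq (s := S.toFinset) (n := s)
    (by rwa [← Set.ncard_eq_toFinset_card']) (by rwa [Fintype.card_fin])
  exact ⟨J.orderEmbOfFin hJ, by simpa [Finset.range_orderEmbOfFin] using hSJ⟩

theorem ncard_le_of_forall_exists_map_subcube {Z : Set (hypercube s).Subgraph}
    {𝒞 : Set (hypercube n).Subgraph}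
    (h : ∀ C ∈ 𝒞, ∃ (e : Fin s ↪o Fin n) (b : Fin n → Bool), ∃ C' ∈ Z,
      C'.map (subcube e.toEmbedding b).toHom = C) :
    𝒞.ncard ≤ n.choose s * 2 ^ (n - s) * Z.ncard := by
  let F : (Σ e : Fin s ↪o Fin n, ↥(Set.range e.toEmbedding)ᶜ → Bool) × (hypercube s).Subgraph →
      (hypercube n).Subgraph :=
    fun q => q.2.map (subcube q.1.1.toEmbedding (baseVertex q.1.2)).toHom
  have hsub : 𝒞 ⊆ F '' (Set.univ ×ˢ Z) := by
    intro C hC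
    obtain ⟨e, b, C', hC', rfl⟩ := h C hC
    refine ⟨(⟨e, fun i => b i⟩, C'), ⟨trivial, hC'⟩, ?_⟩
    exact congrArg (fun f : hypercube s ↪g hypercube n => C'.map f.toHom) (subcube_baseVertex b)
  calc 𝒞.ncard ≤ (F '' (Set.univ ×ˢ Z)).ncard := Set.ncard_le_ncard hsub (Set.toFinite _)
    _ ≤ (Set.univ ×ˢ Z).ncard := Set.ncard_image_le (Set.toFinite _)
    _ = n.choose s * 2 ^ (n - s) * Z.ncard := by
      rw [Set.ncard_prod, Set.ncard_univ, Nat.card_sigma]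
      simp_rw [card_fixedPositions]
      rw [sum_const, card_univ, ← Nat.card_eq_fintype_card, card_orderEmbedding_fin, smul_eq_mul]

variable {W : Type*} {T : SimpleGraph W}

theorem ncard_copies_of_ncard_starPositions_le (hT : T.Connected) (hsn : s ≤ n) :
    {C ∈ copies (hypercube n) T | (starPositions C).ncard ≤ s}.ncard ≤
      n.choose s * 2 ^ (n - s) * (copies (hypercube s) T).ncard := by
  refine ncard_le_of_forall_exists_map_subcube fun C hC => ?_
  obtain ⟨e, he⟩ := exists_orderEmbedding_subset_range hC.2 hsn
  obtain ⟨b, C', rfl⟩ := exists_eq_map_subcube (connected_of_mem_copies hT hC.1) he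
  exact ⟨e, b, C', (map_mem_copies_iff (subcube e.toEmbedding b).toCopy).1 hC.1, rfl⟩

theorem ncard_copies_of_ncard_starPositions_eq (hT : T.Connected) :
    {C ∈ copies (hypercube n) T | (starPositions C).ncard = s}.ncard ≤
      n.choose s * 2 ^ (n - s) *
        {C ∈ copies (hypercube s) T | ∀ i, i ∈ starPositions C}.ncard := by
  refine ncard_le_of_forall_exists_map_subcube fun C hC => ?_
  have hsn : s ≤ n := by simpa [hC.2] using (starPositions C).ncard_le_card
  obtain ⟨e, he⟩ := exists_orderEmbedding_subset_range hC.2.le hsn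
  obtain ⟨b, C', rfl⟩ := exists_eq_map_subcube (connected_of_mem_copies hT hC.1) he
  refine ⟨e, b, C', ⟨(map_mem_copies_iff (subcube e.toEmbedding b).toCopy).1 hC.1,
    fun t => mem_starPositions_of_embedding_mem (b := b) (e := e.toEmbedding) ?_⟩, rfl⟩
  have hrange : starPositions (C'.map (subcube e.toEmbedding b).toHom) = Set.range e :=
    Set.eq_of_subset_of_ncard_le he
      (by rw [Set.ncard_range_of_injective e.injective, hC.2, Nat.card_fin]) (Set.toFinite _)
  exact hrange ▸ ⟨t, rfl⟩

end StarPositions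

section CycleCount

variable {l n : ℕ}

theorem exists_ne_apply_ne_apply_add_one {m : ℕ} {c : Fin (m + 1) → Bool} {p : Fin (m + 1)}
    (hp : c p ≠ c (p + 1)) : ∃ p' ≠ p, c p' ≠ c (p' + 1) := by
  by_contra! hconst
  have hsum : ∑ q, ((c q).toInt - (c (q + 1)).toInt) = 0 := by
    rw [sum_sub_distrib, sub_eq_zero]
    exact (Equiv.sum_comp (Equiv.addRight 1) fun q => (c q).toInt).symm
  rw [sum_eq_single p (fun q _ hq => by rw [hconst q hq, sub_self]) (by simp)] at hsum
  cases h : c p <;> cases h' : c (p + 1) <;> simp_all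

theorem two_mul_ncard_starPositions_le {N : ℕ} (hN : 2 ≤ N) {C : (hypercube n).Subgraph}
    (hC : C ∈ copies (hypercube n) (cycleGraph N)) : 2 * (starPositions C).ncard ≤ N := by
  classical
  obtain ⟨m, rfl⟩ := Nat.exists_eq_add_of_le' hN
  obtain ⟨f, -, rfl⟩ := Copy.toSubgraph_surjOn hC
  have hadj : ∀ p, (hypercube n).Adj (f p) (f (p + 1)) := fun p =>
    f.toHom.map_adj (cycleGraph_adj.2 (Or.inr (add_sub_cancel_left p 1)))
  choose d hd using fun p => hypercube_adj_iff.1 (hadj p)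
  have eq_iff : ∀ p i, d p = i ↔ f p i ≠ f (p + 1) i := fun p i => by
    rw [← hd]
    cases h : f p i <;> simp [flipOn, h, eq_comm (a := i)]
  have hrange : starPositions f.toSubgraph ⊆ univ.image d := by
    rintro i ⟨-, -, ⟨p, p', hpp', rfl, rfl⟩, hne⟩
    rw [coe_image, coe_univ, Set.image_univ]
    rcases cycleGraph_adj.1 hpp' with h | h
    · obtain rfl := eq_add_of_sub_eq' h
      exact ⟨p', (eq_iff p' i).2 hne.symm⟩
    · obtain rfl := eq_add_of_sub_eq' h
      exact ⟨p, (eq_iff p i).2 hne⟩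
  have two_le_fiber : ∀ i ∈ univ.image d, 2 ≤ #{p | d p = i} := by
    intro i hi
    obtain ⟨p, -, rfl⟩ := mem_image.1 hi
    obtain ⟨p', hp', hne⟩ :=
      exists_ne_apply_ne_apply_add_one (c := fun q => f q (d p)) ((eq_iff p _).1 rfl)
    exact one_lt_card.2 ⟨p, by simp, p', by simpa using (eq_iff p' _).2 hne, hp'.symm⟩
  calc 2 * (starPositions f.toSubgraph).ncard ≤ 2 * #(univ.image d) := by
        rw [← Set.ncard_coe_finset]
        exact Nat.mul_le_mul_left 2 (Set.ncard_le_ncard hrange)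
    _ ≤ m + 2 := by simpa using mul_card_image_le_card univ 2 two_le_fiber

theorem copyCount_cycleGraph_le (hl : 2 ≤ l) (hln : l ≤ n + 1) :
    (hypercube n).copyCount (cycleGraph (2 * l)) ≤
      n.choose l * 2 ^ (n - l) * starCycleCount l l +
        n.choose (l - 1) * 2 ^ (n - (l - 1)) *
          (hypercube (l - 1)).copyCount (cycleGraph (2 * l)) := by
  have hconn : (cycleGraph (2 * l)).Connected := by
    obtain ⟨m, hm⟩ := Nat.exists_eq_add_of_le' (show 1 ≤ 2 * l by lia)
    exact hm ▸ cycleGraph_connected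
  rw [copyCount_eq_ncard_copies, copyCount_eq_ncard_copies]
  refine le_trans ?_ (Nat.add_le_add
    (ncard_copies_of_ncard_starPositions_eq (s := l) hconn)
    (ncard_copies_of_ncard_starPositions_le hconn (by lia)))
  refine (Set.ncard_le_ncard (fun C hC => ?_)).trans (Set.ncard_union_le _ _)
  have := two_mul_ncard_starPositions_le (by lia) hC
  rcases (show (starPositions C).ncard = l ∨ (starPositions C).ncard ≤ l - 1 by lia) with h | h
  · exact Or.inl ⟨hC, h⟩
  · exact Or.inr ⟨hC, h⟩

end CycleCount

section LowerBound

variable {l n : ℕ}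

theorem two_mul_le_two_pow (hl : l ≠ 0) : 2 * l ≤ 2 ^ l := by
  obtain ⟨l, rfl⟩ := Nat.exists_eq_succ_of_ne_zero hl
  rw [pow_succ']
  exact Nat.mul_le_mul_left 2 Nat.lt_two_pow_self

theorem one_sub_div_le_div_of_le_add {A B X : ℝ} (hA : 0 < A) (hB : 0 ≤ B) (hX : 0 < X)
    (hle : X ≤ A + B) : 1 - B / A ≤ A / X :=
  calc 1 - B / A = A / (A + B) - B ^ 2 / (A * (A + B)) := by
        field_simp
        ring
    _ ≤ A / (A + B) := sub_le_self _ (by positivity)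
    _ ≤ A / X := by gcongr

/-- An upper bound for the proportion of the copies of `C_{2ℓ}` in `Q_n` that use fewer than `ℓ`
star positions, for `ℓ ≤ n`. The truncated subtraction keeps it non-negative for `n < ℓ`. -/
noncomputable def fewStarsError (l n : ℕ) : ℝ :=
  2 * l * (hypercube (l - 1)).copyCount (cycleGraph (2 * l)) /
    (starCycleCount l l * ((n - l + 1 : ℕ) : ℝ))

theorem fewStarsError_nonneg (l n : ℕ) : 0 ≤ fewStarsError l n := by
  rw [fewStarsError]
  positivity

theorem tendsto_fewStarsError (hl : 2 ≤ l) :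
    Filter.Tendsto (fewStarsError l) Filter.atTop (nhds 0) := by
  refine tendsto_const_nhds.div_atTop
    (Filter.Tendsto.const_mul_atTop (Nat.cast_pos.2 (starCycleCount_pos hl)) ?_)
  exact tendsto_natCast_atTop_atTop.comp
    (Filter.tendsto_atTop_mono (fun n => Nat.le_succ _) (Filter.tendsto_sub_atTop_nat l))

theorem one_sub_fewStarsError_le (hl : 2 ≤ l) (hln : l ≤ n) :
    1 - fewStarsError l n ≤ n.choose l * 2 ^ (n - l) * starCycleCount l l /
      (hypercube n).copyCount (cycleGraph (2 * l)) := by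
  have hz : 0 < (starCycleCount l l : ℝ) := Nat.cast_pos.2 (starCycleCount_pos hl)
  have hchoose : 0 < (n.choose l : ℝ) := Nat.cast_pos.2 (Nat.choose_pos hln)
  have hcopies : 0 < ((hypercube n).copyCount (cycleGraph (2 * l)) : ℝ) :=
    Nat.cast_pos.2 <| copyCount_pos.2 <| cycleGraph_isContained_hypercube hl <|
      (two_mul_le_two_pow (by lia)).trans (Nat.pow_le_pow_right two_pos hln)
  have choose_mul : (n.choose l * l : ℝ) = n.choose (l - 1) * ((n - l + 1 : ℕ) : ℝ) := by
    have h := Nat.choose_succ_right_eq n (l - 1)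
    rw [Nat.sub_add_cancel (by lia), show n - (l - 1) = n - l + 1 by lia] at h
    exact_mod_cast h
  have herror : fewStarsError l n =
      n.choose (l - 1) * 2 ^ (n - (l - 1)) * (hypercube (l - 1)).copyCount (cycleGraph (2 * l)) /
        (n.choose l * 2 ^ (n - l) * starCycleCount l l) := by
    rw [fewStarsError, show n - (l - 1) = n - l + 1 by lia, pow_succ, div_eq_div_iff
      (by positivity) (by positivity)]
    linear_combination (2 * (hypercube (l - 1)).copyCount (cycleGraph (2 * l)) * 2 ^ (n - l) *
      starCycleCount l l : ℝ) * choose_mul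
  rw [herror]
  exact one_sub_div_le_div_of_le_add (by positivity) (by positivity) hcopies
    (mod_cast copyCount_cycleGraph_le hl (by lia))

theorem ceil_logb_two_natCast (m : ℕ) : ⌈Real.logb 2 m⌉ = Nat.clog 2 m := by
  simpa using (Real.ceil_logb_natCast (b := 2) m.cast_nonneg).trans (Int.clog_natCast (R := ℝ) 2 m)

theorem le_genTuranDensity_cycleGraph {k : ℕ} (hk : 2 ≤ k) (hl : 2 ≤ l) (hlk : l ≠ k)
    (hln : l ≤ n) :
    (n.choose l : ℝ)⁻¹ * ((2 : ℝ) ^ ((l : ℤ) - Nat.clog 2 (2 * l)) / starCycleCount l l) *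
      (1 - fewStarsError l n) ≤
        genTuranDensity (hypercube n) (cycleGraph (2 * l)) (cycleGraph (2 * k)) := by
  set q := Nat.clog 2 (2 * l)
  have hql : q ≤ l := (Nat.clog_le_iff_le_pow one_lt_two).2 (two_mul_le_two_pow (by lia))
  have hex : (2 : ℝ) ^ (n - q) ≤
      genEx (hypercube n) (cycleGraph (2 * l)) (cycleGraph (2 * k)) :=
    mod_cast two_pow_le_genEx_cycleGraph hk hl hlk (Nat.le_pow_clog one_lt_two _) (hql.trans hln)
  have hz : (starCycleCount l l : ℝ) ≠ 0 := Nat.cast_ne_zero.2 (starCycleCount_pos hl).ne'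
  have hchoose : (n.choose l : ℝ) ≠ 0 := Nat.cast_ne_zero.2 (Nat.choose_pos hln).ne'
  have hpow : (2 : ℝ) ^ (n - q) = 2 ^ (l - q) * 2 ^ (n - l) := by
    rw [← pow_add]
    congr 1
    lia
  rw [← Nat.cast_sub hql, zpow_natCast]
  calc _ ≤ (n.choose l : ℝ)⁻¹ * (2 ^ (l - q) / starCycleCount l l) *
        (n.choose l * 2 ^ (n - l) * starCycleCount l l /
          (hypercube n).copyCount (cycleGraph (2 * l))) := by
        gcongr
        exact one_sub_fewStarsError_le hl hln
    _ = 2 ^ (n - q) / (hypercube n).copyCount (cycleGraph (2 * l)) := by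
        rw [hpow]
        field_simp
    _ ≤ genTuranDensity (hypercube n) (cycleGraph (2 * l)) (cycleGraph (2 * k)) := by
        rw [genTuranDensity]
        gcongr

end LowerBound

theorem theorem7 (k : ℕ) (hk : 4 ≤ k) (hk5 : k ≠ 5) :
    ∃ c : ℝ, 0 < c ∧ ∀ l : ℕ, 2 ≤ l → l ≠ k →
      0 < starCycleCount l l ∧
      ∃ ε : ℕ → ℝ, (∀ n, 0 ≤ ε n) ∧ Filter.Tendsto ε Filter.atTop (nhds 0) ∧
        ∀ n : ℕ, 2 * l ≤ 2 ^ n →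
          0 < (hypercube n).copyCount (SimpleGraph.cycleGraph (2 * l)) ∧
          (l ≤ n →
            ((n.choose l : ℕ) : ℝ)⁻¹ *
                ((2 : ℝ) ^ ((l : ℤ) - ⌈Real.logb 2 (2 * (l : ℝ))⌉) / (starCycleCount l l : ℝ)) *
                (1 - ε n) ≤
              genTuranDensity (hypercube n) (SimpleGraph.cycleGraph (2 * l))
                (SimpleGraph.cycleGraph (2 * k))) ∧
          genTuranDensity (hypercube n) (SimpleGraph.cycleGraph (2 * l))
              (SimpleGraph.cycleGraph (2 * k)) ≤
            c * (n : ℝ) ^ (-(1 / 16) : ℝ) := by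
  obtain ⟨c, hc, upper_bound⟩ := exists_genTuranDensity_le hk hk5
  refine ⟨c, hc, fun l hl hlk => ⟨starCycleCount_pos hl, fewStarsError l, fewStarsError_nonneg l,
    tendsto_fewStarsError hl, fun n hn => ⟨?_, fun hln => ?_, ?_⟩⟩⟩
  · exact copyCount_pos.2 (cycleGraph_isContained_hypercube hl hn)
  · have hlog := ceil_logb_two_natCast (2 * l)
    push_cast at hlog
    rw [hlog]
    exact le_genTuranDensity_cycleGraph (by lia) hl hlk hln
  · have hn0 : 0 < n := Nat.pos_of_ne_zero fun h => by
      rw [h, pow_zero] at hn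
      lia
    exact upper_bound n hn0 (cycleGraph_ne_bot (by lia))
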